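/- **Setting.** A *skew-symmetric seed* $\mathbf i=(I,I_0,\epsilon)$ consists of a finite set $I$, a subset $I_0\subset I$ of frozen vertices and a skew-symmetric matrix $\epsilon\in\mathbb Q^{I\times I}$ with $\epsilon_{ij}\in\mathbb Z$ for $(i,j)\notin I_0\times I_0$; $n=|I\setminus I_0|$ is its *mutable rank*. It is *connected* if the graph on $I$ with an edge $ij$ whenever $\epsilon_{ij}\ne 0$ is connected, and of *type $L_2$* if $I=\{0,1\}$, $I_0=\emptyset$, $\epsilon_{01}=2$. For $k\in I\setminus I_0$ the mutation $\mu_k$ replaces $\epsilon$ by $\epsilon'$ with $\epsilon'_{ij}=-\epsilon_{ij}$ if $k\in\{i,j\}$ and $\epsilon'_{ij}=\epsilon_{ij}+\frac12(|\epsilon_{ik}|\epsilon_{kj}+\epsilon_{ik}|\epsilon_{kj}|)$ otherwise. It induces the transformations $$A'_k=A_k^{-1}\Big(\prod_{\epsilon_{kj}>0}A_j^{\epsilon_{kj}}+\prod_{\epsilon_{kj}<0}A_j^{-\epsilon_{kj}}\Big),\quad A'_i=A_i\ (i\neq k),\qquad X_k'=X_k^{-1},\quad X_i'=X_i\big(1+X_k^{\operatorname{sgn}\epsilon_{ki}}\big)^{\epsilon_{ki}}\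 (i\ne k)$$ of the coordinates $(A_i)_{i\in I}$ and $(X_i)_{i\in I\setminus I_0}$. A seed isomorphism is a bijection of $I$ that fixes $I_0$ pointwise and carries one exchange matrix to the other; it permutes coordinates. The *cluster modular group* $\Gamma_{|\mathbf i|}$ consists of the finite compositions of mutations and seed isomorphisms from $\mathbf i$ to itself, modulo those that act as the identity on both the $A$- and the $X$-coordinates. It acts on the positive part $\mathcal A(\mathbb R_{>0})\cong\mathbb R_{>0}^I$ of the $\mathcal A$-space. Let $\mathbb S$ be the simplicial complex obtained by gluing $(n-1)$-simplices, whose facets are labelled by $I\setminus I_0$, along equally labelled facets so that the dual graph is the $n$-regular tree. Each maximal simplex carries the seed and the coordinates obtained from the initial ones by the mutations along the tree: $A$-variables on its vertices (the vertex opposite to the facet $i$ carries $A_i$), $X$-variables on its facets co-oriented towards it. The *cluster complex* $\mathcal C=\mathbb S/\Delta$ is the quotient by the group $\Delta$ of the automorphisms that preserve all variables, and $\Gamma_{|\mathbf i|}$ acts on it so that $Z_{\phi(\alpha)}(\phi(g))=Z_\alpha(g)$ for all variables $Z$; its maximal simplices are called *clusters*. For a simplex $\tau$ of $\mathcal C$,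 the *cluster reduction* with respect to $\tau$ is the seed obtained from that of a cluster containing $\tau$ by freezing the vertices of $\tau$; its cluster complex is the link of $\tau$, and its $\mathcal A$-space is the same. The tropical space $\mathcal A(\mathbb R^t)\cong\mathbb R^I$ has at each cluster the coordinates $a_\alpha$ obtained by the tropical limits of the mutations, $a_k'=-a_k+\max\big(\sum_{\epsilon_{kj}>0}\epsilon_{kj}a_j,\ \sum_{\epsilon_{kj}<0}-\epsilon_{kj}a_j\big)$, and $P\mathcal A(\mathbb R^t)=(\mathcal A(\mathbb R^t)\setminus\{0\})/\mathbb R_{>0}$. A point $G\in\mathcal A(\mathbb R^t)$ is *cluster-filling* if $a_\alpha(G)\ne0$ for all vertices $\alpha$ of $\mathcal C$. In the tropical compactification $\overline{\mathcal A}=\mathcal A(\mathbb R_{>0})\sqcup P\mathcal A(\mathbb R^t)$, a sequence $g_m\in\mathcal A(\mathbb R_{>0})$ converges to $[G]$ if and only if, in the coordinates of a cluster, the norm of $\log g_m$ tends to infinity and the direction of $\log g_m$ converges to that of $G$; the theorem asserts this for every cluster. An element $\phi\in\Gamma_{|\mathbf i|}$ is a *cluster Dehn twist* if it has infinite order and some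 power $\phi^l$, $l\neq0$, fixes all vertices of a simplex $\tau$ of $\mathcal C$ with $n-2$ vertices ($\tau=\emptyset$ if $n=2$). Such a $\tau$ is called a *rank-two reduction* of $\phi$. **Theorem.** Let $\mathbf i$ be a skew-symmetric seed that is either connected of mutable rank $n\ge3$ or of type $L_2$, and let $\phi\in\Gamma_{|\mathbf i|}$ be a cluster Dehn twist. Then there is a point $[G]\in P\mathcal A(\mathbb R^t)$ such that, for all $g\in\mathcal A(\mathbb R_{>0})$, $$\lim_{m\to\infty}\phi^{m}(g)=\lim_{m\to\infty}\phi^{-m}(g)=[G]\quad\text{in }\overline{\mathcal A},$$ and $[G]$ is cluster-filling for the cluster reduction of $\mathbf i$ with respect to every rank-two reduction $\tau$ of $\phi$, that is, $a_\alpha(G)\ne0$ for every vertex $\alpha$ of the link of $\tau$ in $\mathcal C$. In particular, $[G]$ is cluster-filling if $\mathbf i$ is of type $L_2$. -/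

import Mathlib

/-- The positive real numbers, a multiplicative group that is closed under addition. -/
abbrev PosReal : Type := {x : ℝ // 0 < x}

/-- A skew-symmetric seed with index set `I` and frozen subset `F`: a skew-symmetric rational
exchange matrix whose entries outside `F × F` are integers. -/
@[ext]
structure Seed (I : Type*) (F : Finset I) where
  ε : I → I → ℚ
  skew : ∀ i j, ε i j = -ε j i
  integral : ∀ i j, i ∉ F ∨ j ∉ F → ∃ m : ℤ, ε i j = m

/-- The mutable vertices. -/
abbrev Mutable {I : Type*} (F : Finset I) : Type _ := {i : I // i ∉ F}

/-- The mutable rank. -/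
noncomputable def mutableRank {I : Type*} (F : Finset I) : ℕ := Nat.card (Mutable F)

/-- The positive real part of the `A`-space, in the chart of the initial seed: all the seed tori
are glued to the initial one by cluster transformations. -/
abbrev APos (I : Type*) : Type _ := I → PosReal

/-- The positive real part of the `X`-space, in the chart of the initial seed. The
`X`-coordinates are indexed by the mutable vertices only. -/
abbrev XPos {I : Type*} (F : Finset I) : Type _ := Mutable F → PosReal

/-- The tropical `A`-space, in the chart of the initial seed. -/
abbrev ATrop (I : Type*) : Type _ := I → ℝ

namespace Seed

variable {I : Type*} [DecidableEq I] {F : Finset I}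

/-! ### Seeds: connectedness, type `L_k`, mutations, isomorphisms -/

/-- The underlying graph of the quiver of a seed, on all vertices, mutable and frozen. -/
def graph {I : Type*} {F : Finset I} (s : Seed I F) : SimpleGraph I where
  Adj i j := s.ε i j ≠ 0
  symm := ⟨fun i j h => by rw [s.skew j i]; simpa using h⟩
  loopless := ⟨fun i h => h (by have := s.skew i i; linarith)⟩

/-- The seed is connected: its quiver is. -/
def IsConnected {I : Type*} {F : Finset I} (s : Seed I F) : Prop := s.graph.Connected

/-- The seed is of type `L_k`: two vertices, none frozen, and `k` arrows between them. -/
def IsTypeL {I : Type*} {F : Finset I} (s : Seed I F) (k : ℕ) : Prop :=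
  F = ∅ ∧ ∃ i j : I, i ≠ j ∧ (∀ x, x = i ∨ x = j) ∧ s.ε i j = k

/-- The entries of the exchange matrix in the row of a mutable vertex, as integers. -/
def b {I : Type*} {F : Finset I} (s : Seed I F) (k : Mutable F) (j : I) : ℤ := (s.ε k j).num

/-- The mutation of a seed directed to the mutable vertex `k`. -/
def mutate (s : Seed I F) (k : Mutable F) : Seed I F where
  ε i j :=
    if i = k ∨ j = k then -s.ε i j
    else s.ε i j + (|s.ε i k| * s.ε k j + s.ε i k * |s.ε k j|) / 2
  skew i j := by
    have h1 := s.skew i j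
    have h2 := s.skew i k
    have h3 := s.skew k j
    by_cases h : i = k ∨ j = k
    · rw [if_pos h, if_pos h.symm, h1]
    · rw [if_neg h, if_neg (fun h' => h h'.symm), h1, h2, h3, abs_neg, abs_neg]
      ring
  integral i j hij := by
    obtain ⟨m, hm⟩ := s.integral i j hij
    obtain ⟨p, hp⟩ := s.integral i k (Or.inr k.2)
    obtain ⟨q, hq⟩ := s.integral k j (Or.inl k.2)
    by_cases h : i = k ∨ j = k
    · exact ⟨-m, by rw [if_pos h, hm]; push_cast; ring⟩
    · rw [if_neg h, hm, hp, hq]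
      rcases le_total 0 p with hp0 | hp0 <;> rcases le_total 0 q with hq0 | hq0 <;>
        have hp' : _ := (Int.cast_le (R := ℚ)).2 hp0 <;>
        have hq' : _ := (Int.cast_le (R := ℚ)).2 hq0 <;>
        rw [Int.cast_zero] at hp' hq'
      · exact ⟨m + p * q, by rw [abs_of_nonneg hp', abs_of_nonneg hq']; push_cast; ring⟩
      · exact ⟨m, by rw [abs_of_nonneg hp', abs_of_nonpos hq']; ring⟩
      · exact ⟨m, by rw [abs_of_nonpos hp', abs_of_nonneg hq']; ring⟩
      · exact ⟨m - p * q, by rw [abs_of_nonpos hp', abs_of_nonpos hq']; push_cast; ring⟩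

/-- `σ` is a seed isomorphism from `s` to `t`. A permutation of the mutable vertices is extended
to all vertices by fixing the frozen ones. -/
def IsIso (σ : Equiv.Perm (Mutable F)) (s t : Seed I F) : Prop :=
  ∀ i j, t.ε (Equiv.Perm.ofSubtype σ i) (Equiv.Perm.ofSubtype σ j) = s.ε i j

theorem b_self {I : Type*} {F : Finset I} (s : Seed I F) (k : Mutable F) : s.b k k = 0 := by
  have h : s.ε k k = 0 := by have := s.skew k k; linarith
  simp [b, h]

theorem mutate_b (s : Seed I F) (k : Mutable F) (j : I) : (s.mutate k).b k j = -s.b k j := by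
  simp [b, mutate]

theorem mutate_mutate (s : Seed I F) (k : Mutable F) : (s.mutate k).mutate k = s := by
  ext i j
  by_cases h : i = k ∨ j = k
  · simp [mutate, h]
  · simp only [mutate, if_neg h, true_or, or_true, if_true, abs_neg]
    ring

/-! ### Cluster transformations -/

/-- The cluster `A`-transformation of the mutation directed to `k`. -/
noncomputable def aMutFun [Fintype I] (s : Seed I F) (k : Mutable F) (A : APos I) : APos I :=
  fun i => if i = k then
      (A k)⁻¹ * (∏ j, A j ^ (s.b k j).toNat + ∏ j, A j ^ (-s.b k j).toNat)
    else A i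

/-- The cluster `X`-transformation of the mutation directed to `k`. -/
noncomputable def xMutFun (s : Seed I F) (k : Mutable F) (X : XPos F) : XPos F :=
  fun i => if i = k then (X k)⁻¹ else X i * (1 + X k ^ (s.b k i).sign) ^ s.b k i

/-- The tropical limit of the cluster `A`-transformation of the mutation directed to `k`. -/
noncomputable def tropMut [Fintype I] (s : Seed I F) (k : Mutable F) (a : ATrop I) : ATrop I :=
  fun i => if i = k then
      -a k + max (∑ j, ((s.b k j).toNat : ℝ) * a j) (∑ j, ((-s.b k j).toNat : ℝ) * a j)
    else a i

theorem aMutFun_aMutFun [Fintype I] (s : Seed I F) (k : Mutable F) (A : APos I) :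
    (s.mutate k).aMutFun k (s.aMutFun k A) = A := by
  have key : ∀ e : I → ℕ, e k = 0 → ∏ j, (s.aMutFun k A) j ^ e j = ∏ j, A j ^ e j := by
    intro e he
    refine Finset.prod_congr rfl fun j _ => ?_
    by_cases h : j = k
    · subst h; simp [he]
    · simp [aMutFun, h]
  funext i
  by_cases h : i = k
  · subst h
    rw [aMutFun, if_pos rfl]
    simp only [mutate_b, neg_neg]
    rw [key _ (by simp [b_self]), key _ (by simp [b_self]), aMutFun, if_pos rfl,
      mul_inv, inv_inv, mul_assoc, add_comm, inv_mul_cancel, mul_one]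
  · simp [aMutFun, h]

theorem xMutFun_xMutFun (s : Seed I F) (k : Mutable F) (X : XPos F) :
    (s.mutate k).xMutFun k (s.xMutFun k X) = X := by
  funext i
  by_cases h : i = k
  · subst h; simp [xMutFun]
  · simp [xMutFun, h, mutate_b, Int.sign_neg]

/-- The cluster `A`-transformation as a bijection of positive real parts. -/
noncomputable def aMut [Fintype I] (s : Seed I F) (k : Mutable F) : Equiv.Perm (APos I) where
  toFun := s.aMutFun k
  invFun := (s.mutate k).aMutFun k
  left_inv := s.aMutFun_aMutFun k
  right_inv A := by
    have h := (s.mutate k).aMutFun_aMutFun k A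
    rwa [mutate_mutate] at h

/-- The cluster `X`-transformation as a bijection of positive real parts. -/
noncomputable def xMut (s : Seed I F) (k : Mutable F) : Equiv.Perm (XPos F) where
  toFun := s.xMutFun k
  invFun := (s.mutate k).xMutFun k
  left_inv := s.xMutFun_xMutFun k
  right_inv X := by
    have h := (s.mutate k).xMutFun_xMutFun k X
    rwa [mutate_mutate] at h

/-- The permutation of the `A`-coordinates induced by a seed isomorphism: the coordinate `σ i` of
the image is the coordinate `i` of the point. -/
def aPerm (σ : Equiv.Perm (Mutable F)) : Equiv.Perm (APos I) :=
  (Equiv.Perm.ofSubtype σ).arrowCongr (Equiv.refl PosReal)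

/-- The permutation of the `X`-coordinates induced by a seed isomorphism. -/
def xPerm (σ : Equiv.Perm (Mutable F)) : Equiv.Perm (XPos F) :=
  σ.arrowCongr (Equiv.refl PosReal)

/-- `ClusterTransformation s t f h`: some seed cluster transformation from `s` to `t`, that is, a
finite composition of mutations and seed isomorphisms, induces the transformation `f` of the
`A`-space and the transformation `h` of the `X`-space. -/
inductive ClusterTransformation [Fintype I] :
    Seed I F → Seed I F → Equiv.Perm (APos I) → Equiv.Perm (XPos F) → Prop
  | refl (s : Seed I F) : ClusterTransformation s s 1 1
  | mutate {s t : Seed I F} {f : Equiv.Perm (APos I)} {h : Equiv.Perm (XPos F)}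
      (k : Mutable F) : ClusterTransformation s t f h →
      ClusterTransformation s (t.mutate k) (t.aMut k * f) (t.xMut k * h)
  | iso {s t t' : Seed I F} {f : Equiv.Perm (APos I)} {h : Equiv.Perm (XPos F)}
      (σ : Equiv.Perm (Mutable F)) : IsIso σ t t' → ClusterTransformation s t f h →
      ClusterTransformation s t' (aPerm σ * f) (xPerm σ * h)

theorem ClusterTransformation.trans [Fintype I] {s t u : Seed I F}
    {f f' : Equiv.Perm (APos I)} {h h' : Equiv.Perm (XPos F)}
    (H : ClusterTransformation s t f h) (H' : ClusterTransformation t u f' h') :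
    ClusterTransformation s u (f' * f) (h' * h) := by
  induction H' with
  | refl => simpa using H
  | mutate k _ ih => simpa only [mul_assoc] using ih.mutate k
  | iso σ hσ _ ih => simpa only [mul_assoc] using ih.iso σ hσ

theorem ClusterTransformation.symm [Fintype I] {s t : Seed I F}
    {f : Equiv.Perm (APos I)} {h : Equiv.Perm (XPos F)}
    (H : ClusterTransformation s t f h) : ClusterTransformation t s f⁻¹ h⁻¹ := by
  induction H with
  | refl => simpa using ClusterTransformation.refl s
  | @mutate t f h k _ ih =>
    have h1 := (ClusterTransformation.refl (t.mutate k)).mutate k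
    rw [mutate_mutate, mul_one, mul_one] at h1
    have ha : (t.mutate k).aMut k = (t.aMut k)⁻¹ := Equiv.ext fun _ => rfl
    have hx : (t.mutate k).xMut k = (t.xMut k)⁻¹ := Equiv.ext fun _ => rfl
    rw [ha, hx] at h1
    simpa only [mul_inv_rev] using h1.trans ih
  | @iso t t' f h σ hσ _ ih =>
    have h1 := (ClusterTransformation.refl t').iso (t' := t) σ⁻¹ (fun i j => by
      rw [← hσ, ← Equiv.Perm.mul_apply, ← Equiv.Perm.mul_apply, ← map_mul, mul_inv_cancel,
        map_one]; rfl)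
    have ha : aPerm (I := I) σ⁻¹ = (aPerm σ)⁻¹ := by
      simp only [aPerm, map_inv]; rfl
    have hx : xPerm (F := F) σ⁻¹ = (xPerm σ)⁻¹ := rfl
    rw [mul_one, mul_one, ha, hx] at h1
    simpa only [mul_inv_rev] using h1.trans ih

/-- The cluster modular group: the seed cluster transformations from `s` to itself, two of them
being identified if they induce the same transformations of the `A`-space and of the `X`-space.
(A positive rational map between tori is determined by its values on the positive real part.) -/
def modularGroup [Fintype I] (s : Seed I F) :
    Subgroup (Equiv.Perm (APos I) × Equiv.Perm (XPos F)) where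
  carrier := {φ | ClusterTransformation s s φ.1 φ.2}
  one_mem' := ClusterTransformation.refl s
  mul_mem' ha hb := hb.trans ha
  inv_mem' ha := ha.symm

/-- The action of the cluster modular group on the positive real part of the `A`-space. -/
def aAct [Fintype I] {s : Seed I F} (φ : s.modularGroup) (g : APos I) : APos I := φ.1.1 g

/-- The action of the cluster modular group on the positive real part of the `X`-space. -/
def xAct [Fintype I] {s : Seed I F} (φ : s.modularGroup) (g : XPos F) : XPos F := φ.1.2 g

/-! ### The tree of clusters and its charts -/

/-- The maximal simplices of the universal decorated complex, that is, the vertices of its dual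
tree: reduced words in the mutable vertices. The empty word is the initial simplex, and the
reflection of `w` in its facet with label `k` is `k :: w` (or `w` without its head, if that is
`k`). -/
abbrev Simplex (F : Finset I) : Type _ := {w : List (Mutable F) // w.IsChain (· ≠ ·)}

/-- The seed obtained from `s` by the mutations along a word; the last letter acts first. -/
def seedAt (s : Seed I F) : List (Mutable F) → Seed I F
  | [] => s
  | k :: w => (s.seedAt w).mutate k

/-- The `A`-coordinates of the seed at a word, as functions of the initial ones. -/
noncomputable def aChart [Fintype I] (s : Seed I F) : List (Mutable F) → APos I → APos I
  | [], g => g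
  | k :: w, g => (s.seedAt w).aMut k (s.aChart w g)

/-- The `X`-coordinates of the seed at a word, as functions of the initial ones. -/
noncomputable def xChart (s : Seed I F) : List (Mutable F) → XPos F → XPos F
  | [], g => g
  | k :: w, g => (s.seedAt w).xMut k (s.xChart w g)

/-- The tropical `A`-coordinates of the seed at a word, as functions of the initial ones. -/
noncomputable def tropChart [Fintype I] (s : Seed I F) : List (Mutable F) → ATrop I → ATrop I
  | [], G => G
  | k :: w, G => (s.seedAt w).tropMut k (s.tropChart w G)

/-- A simplex and its reflection in the facet with label `k` share their vertices with labels
`i ≠ k`. -/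
inductive VertexRel (F : Finset I) : Simplex F × Mutable F → Simplex F × Mutable F → Prop
  | reflect (w : Simplex F) (k i : Mutable F) (hw : (k :: w.1).IsChain (· ≠ ·)) (hi : i ≠ k) :
      VertexRel F (w, i) (⟨k :: w.1, hw⟩, i)

/-- The vertices of the universal decorated complex. -/
def Vertex (F : Finset I) : Type _ := Quot (VertexRel F)

/-- The vertex of the simplex `w` with label `i` (opposite to the facet with label `i`). -/
def vertex (w : Simplex F) (i : Mutable F) : Vertex F := Quot.mk _ (w, i)

/-- The set of vertices of a maximal simplex. -/
def verticesOf (w : Simplex F) : Set (Vertex F) := Set.range (vertex w)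

/-- The tropical `A`-variable `a_α` of a vertex `α`. -/
noncomputable def tropVar [Fintype I] (s : Seed I F) (α : Vertex F) (G : ATrop I) : ℝ :=
  Quot.lift (fun p : Simplex F × Mutable F => s.tropChart p.1.1 G p.2)
    (by
      rintro _ _ ⟨w, k, i, hw, hi⟩
      have h : (i : I) ≠ k := fun h => hi (Subtype.ext h)
      simp [tropChart, tropMut, h]) α

/-- Automorphisms of the universal decorated complex, as a simplicial complex: bijections of its
vertices that map maximal simplices to maximal simplices, in both directions. -/
def IsAut (γ : Equiv.Perm (Vertex F)) : Prop :=
  (∀ w, ∃ w', γ '' verticesOf w = verticesOf w') ∧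
    ∀ w, ∃ w', γ.symm '' verticesOf w = verticesOf w'

/-- `γ` represents the mapping class `φ` on the universal decorated complex: it is an automorphism
that preserves the exchange matrices and satisfies `Z_{γ α} (φ g) = Z_α g` for all the variables of
the `A`- and of the `X`-space. The `X`-variables belong to the facets of a maximal simplex,
co-oriented towards this simplex. The automorphisms that represent the identity form the group
by which the universal decorated complex is divided to get the cluster complex, and those that
represent `φ` form a coset of it: they are the lifts of the action of `φ` on the cluster
complex. -/
def Represents [Fintype I] (s : Seed I F) (γ : Equiv.Perm (Vertex F)) (φ : s.modularGroup) :
    Prop :=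
  IsAut γ ∧
  ∀ (w w' : Simplex F) (σ : Equiv.Perm (Mutable F)), (∀ i, γ (vertex w i) = vertex w' (σ i)) →
    IsIso σ (s.seedAt w.1) (s.seedAt w'.1) ∧
    (∀ (g : APos I) (i : I),
      s.aChart w'.1 (aAct φ g) (Equiv.Perm.ofSubtype σ i) = s.aChart w.1 g i) ∧
    ∀ (g : XPos F) (i : Mutable F), s.xChart w'.1 (xAct φ g) (σ i) = s.xChart w.1 g i

/-! ### Cluster Dehn twists and cluster-filling points -/

/-- `φ ^ l`, `l ≠ 0`, fixes every vertex of a simplex of the cluster complex that has two vertices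
less than a cluster, so that the cluster reduction with respect to it has mutable rank two. The
simplex of the cluster complex is given by a simplex `τ` that lies over it. -/
def IsRankTwoReduction [Fintype I] (s : Seed I F) (φ : s.modularGroup) (l : ℤ)
    (τ : Set (Vertex F)) : Prop :=
  l ≠ 0 ∧ τ.ncard + 2 = mutableRank F ∧ (∃ w, τ ⊆ verticesOf w) ∧
    ∃ γ, s.Represents γ (φ ^ l) ∧ ∀ α ∈ τ, γ α = α

/-- Cluster Dehn twists: mapping classes of infinite order with a non-trivial power that is
reducible to rank two. -/
def IsClusterDehnTwist [Fintype I] (s : Seed I F) (φ : s.modularGroup) : Prop :=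
  ¬ IsOfFinOrder φ ∧ ∃ l τ, s.IsRankTwoReduction φ l τ

/-- Cluster-filling points of the tropical `A`-space. -/
def IsClusterFilling [Fintype I] (s : Seed I F) (G : ATrop I) : Prop :=
  ∀ α : Vertex F, s.tropVar α G ≠ 0

/-- The vertices of the link of a simplex: they are the vertices of the cluster complex of the
seed obtained by the cluster reduction with respect to `τ`. -/
def linkVertices (τ : Set (Vertex F)) : Set (Vertex F) :=
  {α | α ∉ τ ∧ ∃ w, τ ⊆ verticesOf w ∧ α ∈ verticesOf w}

/-- The point is cluster-filling for the seed obtained by the cluster reduction with respect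
to `τ`, which has the same tropical `A`-space. -/
def IsClusterFillingRel [Fintype I] (s : Seed I F) (τ : Set (Vertex F)) (G : ATrop I) : Prop :=
  ∀ α ∈ linkVertices τ, s.tropVar α G ≠ 0

/-! ### The tropical compactification -/

theorem tropChart_smul [Fintype I] (s : Seed I F) (w : List (Mutable F)) {c : ℝ} (hc : 0 < c)
    (G : ATrop I) : s.tropChart w (c • G) = c • s.tropChart w G := by
  induction w with
  | nil => rfl
  | cons k w ih =>
    funext i
    by_cases h : i = k
    · simp only [tropChart, tropMut, ih, h, if_true, Pi.smul_apply, smul_eq_mul, mul_add,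
        mul_max_of_nonneg _ _ hc.le, Finset.mul_sum, mul_left_comm c, mul_neg]
    · simp [tropChart, tropMut, ih, h]

/-- The tropical compactification of the `A`-space, as a set: the positive real part and the
projectivized tropical space. -/
abbrev ABar (I : Type*) : Type _ := APos I ⊕ Module.Ray ℝ (ATrop I)

/-- Radial coordinates on the tropical compactification with respect to the chart at `w`: the
positive real part is mapped onto the open unit ball by `x ↦ x / (1 + ‖x‖)`, where `x` is the
vector of the logarithms of the coordinates, and a boundary point `[G]` to the unit vector in the
direction of the tropical coordinates of `G`. -/
noncomputable def ballCoord [Fintype I] (s : Seed I F) (w : Simplex F) : ABar I → I → ℝ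
  | Sum.inl g =>
      let x : I → ℝ := fun i => Real.log (s.aChart w.1 g i : ℝ)
      (1 + ‖x‖)⁻¹ • x
  | Sum.inr r =>
      Quotient.lift
        (fun G : RayVector ℝ (ATrop I) =>
          ‖s.tropChart w.1 (G : ATrop I)‖⁻¹ • s.tropChart w.1 (G : ATrop I))
        (by
          intro G G' (h : SameRay ℝ (G : ATrop I) (G' : ATrop I))
          obtain ⟨c, hc, h⟩ := h.exists_pos_left G.2 G'.2
          simp only [← h, tropChart_smul s w.1 hc, norm_smul, Real.norm_of_nonneg hc.le, mul_inv,
            smul_smul]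
          rw [mul_right_comm, inv_mul_cancel₀ hc.ne', one_mul]) r

/-- The topology of the spherical compactification, defined with the chart at `w`. -/
@[reducible]
noncomputable def aBarTopology [Fintype I] (s : Seed I F) (w : Simplex F) :
    TopologicalSpace (ABar I) :=
  TopologicalSpace.induced (s.ballCoord w) inferInstance

/-- The sequence `u` in the positive real part converges to `[G]` in the tropical compactification,
with respect to the topology defined by any of the charts. -/
def ConvergesTo [Fintype I] (s : Seed I F) (u : ℕ → APos I) (r : Module.Ray ℝ (ATrop I)) : Prop :=
  ∀ w : Simplex F, Filter.Tendsto (fun m => (Sum.inl (u m) : ABar I)) Filter.atTop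
    (@nhds _ (s.aBarTopology w) (Sum.inr r))

end Seed

set_option linter.unusedSectionVars false

namespace Seed

variable {I : Type*} [DecidableEq I] {F : Finset I}

/-! A nontrivial power of a cluster Dehn twist fixes all but two vertices of a cluster, so it moves
only within the clusters that share a simplex `τ` with `n - 2` vertices. In the tree these clusters
form a line along which the mutable labels `i` and `j` alternate. An automorphism that keeps `τ`
acts on this line as a translation or a reflection. A reflection would have order at most two, so
the square of the power is an alternating loop of even length `R` returning to the same exchange
matrix (`IsRankTwoReduction.exists_loop`).

The matrix restricts the loop. If at most one arrow joins `i` and `j`, the square or the pentagon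
relation makes the loop of finite order (`isOfFinOrder_chart_alt`). Otherwise the arrows from a
third vertex `k` to the pair satisfy `d (n + 2) + d n = B * max (d (n + 1)) 0`, up to an overall
sign, with `B ≥ 2`. A periodic solution is constant, nonnegative and annihilated by `B - 2`
(`eq_of_periodic_recurrence`). Connectedness in rank at least three supplies a nonzero solution, and
type `L_2` gives `B = 2` directly. Hence the pair is affine: a double arrow, with every other
adjacent vertex spanning an oriented cycle with it.

In an affine pair the mutated variables satisfy `x (n + 2) * x n = x (n + 1) ^ 2 + K` with a
constant `K > 0`. The quotient `(x (n + 2) + x n) / x (n + 1)` is conserved, whence consecutive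
logarithms differ by a bounded amount and tend to infinity (`log_of_affine_recurrence`), while all
other coordinates stay fixed. The orbit thus follows the ray of `pairVec i j`, the sum of the two
basis vectors, and so does the inverse orbit, since the inverse loop is the one with `i` and `j`
exchanged. Mutations stay within `log 2` of their tropical limits, which are Lipschitz and
homogeneous, so the asymptotic direction passes to every chart (`asymptoticTo_aChart`).

The tropical mutations of the line fix `pairVec i j`, so both coordinates of the pair equal `1` in
all clusters containing `τ`; this is the filling property. Uniqueness of limits identifies the
points obtained from different reductions. -/

theorem seedAt_append (s : Seed I F) (u v : List (Mutable F)) :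
    s.seedAt (u ++ v) = (s.seedAt v).seedAt u := by
  induction u with
  | nil => rfl
  | cons k u ih => simp [seedAt, ih]

theorem seedAt_reverse (s : Seed I F) (u : List (Mutable F)) :
    (s.seedAt u).seedAt u.reverse = s := by
  induction u with
  | nil => rfl
  | cons k u ih => simp [seedAt, seedAt_append, mutate_mutate, ih]

/-! ### Charts as pairs of permutations -/

section Charts

variable [Fintype I]

/-- The transformations of the `A`- and the `X`-space of a mutation. -/
noncomputable def mutPair (s : Seed I F) (k : Mutable F) :
    Equiv.Perm (APos I) × Equiv.Perm (XPos F) :=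
  (s.aMut k, s.xMut k)

/-- The transformations of the `A`- and the `X`-space of a seed isomorphism. -/
def permPair (σ : Equiv.Perm (Mutable F)) : Equiv.Perm (APos I) × Equiv.Perm (XPos F) :=
  (aPerm σ, xPerm σ)

/-- The coordinate change along a word, on the `A`- and the `X`-space. -/
noncomputable def chart (s : Seed I F) :
    List (Mutable F) → Equiv.Perm (APos I) × Equiv.Perm (XPos F)
  | [] => 1
  | k :: w => (s.seedAt w).mutPair k * s.chart w

theorem chart_fst (s : Seed I F) (w : List (Mutable F)) (g : APos I) :
    (s.chart w).1 g = s.aChart w g := by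
  induction w with
  | nil => rfl
  | cons k w ih => simp [chart, aChart, ← ih, mutPair]

theorem chart_snd (s : Seed I F) (w : List (Mutable F)) (g : XPos F) :
    (s.chart w).2 g = s.xChart w g := by
  induction w with
  | nil => rfl
  | cons k w ih => simp [chart, xChart, ← ih, mutPair]

theorem chart_append (s : Seed I F) (u v : List (Mutable F)) :
    s.chart (u ++ v) = (s.seedAt v).chart u * s.chart v := by
  induction u with
  | nil => simp [chart]
  | cons k u ih => simp [chart, ih, seedAt_append, mul_assoc]

theorem mutPair_mutate (s : Seed I F) (k : Mutable F) :
    (s.mutate k).mutPair k = (s.mutPair k)⁻¹ := by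
  refine Prod.ext (Equiv.ext fun _ => rfl) (Equiv.ext fun _ => rfl)

theorem chart_reverse (s : Seed I F) (u : List (Mutable F)) :
    (s.seedAt u).chart u.reverse = (s.chart u)⁻¹ := by
  induction u with
  | nil => simp [chart]
  | cons k u ih =>
    simp [seedAt, chart, chart_append, mutate_mutate, ih, mutPair_mutate]

/-! ### Equivariance under seed isomorphisms -/

theorem ofSubtype_eq_coe_iff (σ : Equiv.Perm (Mutable F)) (i : I) (k : Mutable F) :
    Equiv.Perm.ofSubtype σ i = (σ k : I) ↔ i = k := by
  rw [← Equiv.Perm.ofSubtype_apply_coe σ k, EmbeddingLike.apply_eq_iff_eq]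

theorem IsIso.mutate {σ : Equiv.Perm (Mutable F)} {t t' : Seed I F} (h : IsIso σ t t')
    (k : Mutable F) : IsIso σ (t.mutate k) (t'.mutate (σ k)) := by
  intro i j
  have hk (j : I) := h k j
  have hk' (i : I) := h i k
  simp only [Equiv.Perm.ofSubtype_apply_coe] at hk hk'
  simp only [Seed.mutate, ofSubtype_eq_coe_iff, h i j, hk, hk']

theorem IsIso.seedAt {σ : Equiv.Perm (Mutable F)} {t t' : Seed I F} (h : IsIso σ t t')
    (u : List (Mutable F)) : IsIso σ (t.seedAt u) (t'.seedAt (u.map σ)) := by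
  induction u with
  | nil => exact h
  | cons k u ih => exact ih.mutate k

/-- Closes the loop of double length when an isomorphism that is an involution on labels has been
transported once along a word. -/
theorem IsIso.eq_of_sq {σ : Equiv.Perm (Mutable F)} {t t' t'' : Seed I F} (h : IsIso σ t t')
    (h' : IsIso σ t' t'') (hσ : σ * σ = 1) : t'' = t := by
  have hid (i : I) : Equiv.Perm.ofSubtype σ (Equiv.Perm.ofSubtype σ i) = i := by
    rw [← Equiv.Perm.mul_apply, ← map_mul, hσ, map_one]; rfl
  ext i j
  rw [← h i j, ← h' _ _, hid, hid]

theorem aPerm_apply (σ : Equiv.Perm (Mutable F)) (g : APos I) (i : I) :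
    aPerm σ g (Equiv.Perm.ofSubtype σ i) = g i := by
  simp [aPerm, Equiv.arrowCongr]

theorem xPerm_apply (σ : Equiv.Perm (Mutable F)) (g : XPos F) (i : Mutable F) :
    xPerm σ g (σ i) = g i := by
  simp [xPerm, Equiv.arrowCongr]

theorem IsIso.b {σ : Equiv.Perm (Mutable F)} {t t' : Seed I F} (h : IsIso σ t t')
    (k : Mutable F) (j : I) : t'.b (σ k) (Equiv.Perm.ofSubtype σ j) = t.b k j := by
  simp only [Seed.b]
  rw [← h k j, Equiv.Perm.ofSubtype_apply_coe]

/-- Mutation is natural under relabelling: the exchange monomials are products over all vertices, so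
a seed isomorphism only reindexes them. -/
theorem IsIso.permPair_mul_mutPair {σ : Equiv.Perm (Mutable F)} {t t' : Seed I F}
    (h : IsIso σ t t') (k : Mutable F) :
    permPair σ * t.mutPair k = t'.mutPair (σ k) * permPair σ := by
  refine Prod.ext (Equiv.ext fun g => funext fun i => ?_) (Equiv.ext fun g => funext fun i => ?_)
  · obtain ⟨i, rfl⟩ := (Equiv.Perm.ofSubtype σ).surjective i
    have hp (e : I → ℕ) : ∏ j, aPerm σ g j ^ e j
        = ∏ j, g j ^ e (Equiv.Perm.ofSubtype σ j) := by
      rw [← Equiv.prod_comp (Equiv.Perm.ofSubtype σ)]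
      simp only [aPerm_apply]
    change aPerm σ (t.aMutFun k g) _ = t'.aMutFun (σ k) (aPerm σ g) _
    rw [aPerm_apply]
    have hk : aPerm σ g (σ k) = g k := by
      rw [← Equiv.Perm.ofSubtype_apply_coe, aPerm_apply]
    simp only [aMutFun, ofSubtype_eq_coe_iff, hp, h.b, hk, aPerm_apply]
  · obtain ⟨i, rfl⟩ := σ.surjective i
    change xPerm σ (t.xMutFun k g) _ = t'.xMutFun (σ k) (xPerm σ g) _
    have hb := h.b k i
    rw [Equiv.Perm.ofSubtype_apply_coe] at hb
    simp only [xPerm_apply, xMutFun, EmbeddingLike.apply_eq_iff_eq, hb]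

theorem IsIso.permPair_mul_chart {σ : Equiv.Perm (Mutable F)} {t t' : Seed I F}
    (h : IsIso σ t t') (u : List (Mutable F)) :
    permPair σ * t.chart u = t'.chart (u.map σ) * permPair σ := by
  induction u with
  | nil => simp [chart]
  | cons k u ih =>
    simp only [chart, List.map_cons]
    rw [← mul_assoc, (h.seedAt u).permPair_mul_mutPair, mul_assoc, ih, mul_assoc]

theorem permPair_mul_self {σ : Equiv.Perm (Mutable F)} (hσ : σ * σ = 1) :
    permPair (I := I) σ * permPair σ = 1 := by
  refine Prod.ext (Equiv.ext fun g => funext fun i => ?_) (Equiv.ext fun g => funext fun i => ?_)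
  · have hid : Equiv.Perm.ofSubtype σ (Equiv.Perm.ofSubtype σ i) = i := by
      rw [← Equiv.Perm.mul_apply, ← map_mul, hσ, map_one]; rfl
    change aPerm σ (aPerm σ g) i = g i
    conv_lhs => rw [← hid]
    rw [aPerm_apply, aPerm_apply]
  · have hid : σ (σ i) = i := by
      rw [← Equiv.Perm.mul_apply, hσ]; rfl
    change xPerm σ (xPerm σ g) i = g i
    conv_lhs => rw [← hid]
    rw [xPerm_apply, xPerm_apply]

end Charts

/-! ### Alternating words -/

/-- The letter at time `m` of the alternating sequence `i, j, i, j, …`. -/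
def lab (i j : Mutable F) (m : ℕ) : Mutable F := if Even m then i else j

/-- The alternating word of length `m` whose first acting (last written) letter is `i`. -/
def alt (i j : Mutable F) : ℕ → List (Mutable F)
  | 0 => []
  | m + 1 => lab i j m :: alt i j m

@[simp] theorem lab_zero (i j : Mutable F) : lab i j 0 = i := by simp [lab]
@[simp] theorem lab_one (i j : Mutable F) : lab i j 1 = j := by simp [lab]
theorem lab_add_two (i j : Mutable F) (m : ℕ) : lab i j (m + 2) = lab i j m := by
  simp [lab, Nat.even_add]
theorem lab_even (i j : Mutable F) {m : ℕ} (h : Even m) : lab i j m = i := if_pos h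
theorem lab_odd (i j : Mutable F) {m : ℕ} (h : ¬ Even m) : lab i j m = j := if_neg h

theorem lab_shift (i j : Mutable F) (r m : ℕ) :
    lab (lab i j r) (lab i j (r + 1)) m = lab i j (m + r) := by
  by_cases h : Even r <;> by_cases h' : Even m <;> simp [lab, h, h', Nat.even_add]

theorem lab_ne {i j : Mutable F} (h : i ≠ j) (m : ℕ) : lab i j m ≠ lab i j (m + 1) := by
  by_cases h' : Even m <;> simp [lab, h', Nat.even_add, h, h.symm]

theorem lab_eq_or (i j : Mutable F) (m : ℕ) : lab i j m = i ∨ lab i j m = j := by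
  by_cases h' : Even m <;> simp [lab, h']

theorem map_alt (σ : Mutable F → Mutable F) (i j : Mutable F) (m : ℕ) :
    (alt i j m).map σ = alt (σ i) (σ j) m := by
  induction m with
  | zero => rfl
  | succ m ih =>
    simp only [alt, List.map_cons, ih]
    by_cases h' : Even m <;> simp [lab, h']

theorem alt_add (i j : Mutable F) (r m : ℕ) :
    alt i j (m + r) = alt (lab i j r) (lab i j (r + 1)) m ++ alt i j r := by
  induction m with
  | zero => simp [alt]
  | succ m ih => rw [Nat.succ_add, alt, ih, alt, lab_shift, List.cons_append]

/-- The reversed word acts first by the last letter of the original, at time `m - 1`; by parity this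
is `lab i j (m + 1)`, which also makes sense for `m = 0`. -/
theorem reverse_alt (i j : Mutable F) (m : ℕ) :
    (alt i j m).reverse = alt (lab i j (m + 1)) (lab i j m) m := by
  induction m with
  | zero => rfl
  | succ m ih =>
    rw [alt, List.reverse_cons, ih, lab_add_two, alt_add _ _ 1 m]
    simp [alt, lab]

theorem cons_alt_of_isChain {i j k : Mutable F} (n : ℕ) (hk : k = i ∨ k = j)
    (hc : (k :: alt i j n).IsChain (· ≠ ·)) :
    k :: alt i j n = alt i j (n + 1) ∨ k :: alt i j n = alt j i (n + 1) := by
  cases n with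
  | zero => rcases hk with rfl | rfl <;> simp [alt]
  | succ n =>
    left
    rw [alt] at hc
    have h1 := (List.isChain_cons_cons.1 hc).1
    rw [alt]
    congr 1
    by_cases hn : Even n
    · rw [lab_even _ _ hn] at h1
      rw [lab_odd _ _ (by simpa [Nat.even_add] using hn)]
      tauto
    · rw [lab_odd _ _ hn] at h1
      rw [lab_even _ _ (by simpa [Nat.even_add] using hn)]
      tauto

/-- A reduced word in two letters alternates. -/
theorem eq_alt_of_isChain {i j : Mutable F} (u : List (Mutable F))
    (hu : u.IsChain (· ≠ ·)) (h : ∀ a ∈ u, a = i ∨ a = j) :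
    u = alt i j u.length ∨ u = alt j i u.length := by
  induction u with
  | nil => simp [alt]
  | cons k u ih =>
    have hk := h k (by simp)
    rcases ih hu.tail (fun a ha => h a (by simp [ha])) with e | e <;> rw [e] at hu ⊢
    · simpa [← e] using cons_alt_of_isChain u.length hk hu
    · simpa [← e] using (cons_alt_of_isChain u.length hk.symm hu).symm

/-! ### Exchange matrices along an alternating sequence of mutations -/

theorem cast_b (s : Seed I F) (k : Mutable F) (j : I) : (s.b k j : ℚ) = s.ε k j := by
  obtain ⟨m, hm⟩ := s.integral k j (Or.inl k.2)
  simp [b, hm]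

theorem b_skew (s : Seed I F) (k l : Mutable F) : s.b k l = -s.b l k := by
  have h : (s.b k l : ℚ) = ((-s.b l k : ℤ) : ℚ) := by
    push_cast
    rw [cast_b, cast_b, s.skew]
  exact_mod_cast h

/-- The row of the vertex that is mutated at time `n`, before this mutation. -/
def row (t : Seed I F) (i j : Mutable F) (n : ℕ) (k : I) : ℤ :=
  (t.seedAt (alt i j n)).b (lab i j n) k

/-- Each mutation changes the sign of the entry, and the exchange of the two roles changes it back
by skew-symmetry. -/
theorem b_lab_succ_lab (t : Seed I F) (i j : Mutable F) (n : ℕ) :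
    (t.seedAt (alt i j n)).b (lab i j (n + 1)) (lab i j n) = t.b j i := by
  induction n with
  | zero => simp [alt, seedAt]
  | succ n ih =>
    rw [lab_add_two, alt, seedAt, mutate_b, b_skew, neg_neg, ih]

theorem row_lab_succ (t : Seed I F) (i j : Mutable F) (n : ℕ) :
    t.row i j n (lab i j (n + 1)) = -t.b j i := by
  rw [row, b_skew, b_lab_succ_lab]

theorem row_succ (t : Seed I F) {i j : Mutable F} (hij : i ≠ j) (n : ℕ) {k : I} (hi : k ≠ i)
    (hj : k ≠ j) :
    2 * t.row i j (n + 1) k = 2 * (t.seedAt (alt i j n)).b (lab i j (n + 1)) k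
      + (|t.b j i| * t.row i j n k + t.b j i * |t.row i j n k|) := by
  have h1 : (lab i j (n + 1) : I) ≠ lab i j n := fun h => lab_ne hij n (Subtype.ext h.symm)
  have h2 : k ≠ lab i j n := by rcases lab_eq_or i j n with h | h <;> rw [h] <;> assumption
  have hb := b_lab_succ_lab t i j n
  have h : (2 * t.row i j (n + 1) k : ℚ) = 2 * (t.seedAt (alt i j n)).b (lab i j (n + 1)) k
      + (|(t.b j i : ℚ)| * t.row i j n k + t.b j i * |(t.row i j n k : ℚ)|) := by
    rw [← hb]
    simp only [row, cast_b, alt, seedAt]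
    conv_lhs => rw [mutate]
    simp only [h1, h2, or_self, if_false]
    ring
  exact_mod_cast h

/-- The row mutated at time `n` is negated there and next altered at time `n + 1`, so the rows of
the two alternating vertices merge into one second-order recurrence. The factor `2` clears the
denominator of the mutation rule. -/
theorem row_add_two (t : Seed I F) {i j : Mutable F} (hij : i ≠ j) (n : ℕ) {k : I} (hi : k ≠ i)
    (hj : k ≠ j) :
    2 * (t.row i j (n + 2) k + t.row i j n k)
      = |t.b j i| * t.row i j (n + 1) k + t.b j i * |t.row i j (n + 1) k| := by
  have h := row_succ t hij (n + 1) hi hj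
  rw [lab_add_two, alt, seedAt, mutate_b] at h
  change _ = 2 * -(t.row i j n k) + _ at h
  linarith

/-! ### `A`-coordinates along an alternating sequence of mutations -/

section ASide

variable [Fintype I]

/-- The `A`-coordinate that is mutated at time `n`, before this mutation. -/
noncomputable def aSeq (t : Seed I F) (i j : Mutable F) (A : APos I) (n : ℕ) : ℝ :=
  t.aChart (alt i j n) A (lab i j n)

/-- The monomial of the other `A`-coordinates with given exponents. -/
noncomputable def restMonomial (i j : Mutable F) (A : APos I) (e : I → ℤ) : ℝ :=
  ∏ k ∈ Finset.univ.filter (fun k : I => k ≠ i ∧ k ≠ j), (A k : ℝ) ^ (e k).toNat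

theorem restMonomial_pos (i j : Mutable F) (A : APos I) (e : I → ℤ) :
    0 < restMonomial i j A e :=
  Finset.prod_pos fun k _ => pow_pos (A k).2 _

theorem aSeq_pos (t : Seed I F) (i j : Mutable F) (A : APos I) (n : ℕ) : 0 < t.aSeq i j A n :=
  Subtype.prop _

theorem aChart_succ_of_ne (t : Seed I F) (i j : Mutable F) (A : APos I) (n : ℕ) {k : I}
    (h : k ≠ lab i j n) :
    t.aChart (alt i j (n + 1)) A k = t.aChart (alt i j n) A k := by
  simp [alt, aChart, aMut, aMutFun, h]

theorem aChart_alt_of_ne (t : Seed I F) (i j : Mutable F) (A : APos I) (n : ℕ) {k : I}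
    (hi : k ≠ i) (hj : k ≠ j) : t.aChart (alt i j n) A k = A k := by
  induction n with
  | zero => rfl
  | succ n ih =>
    rw [aChart_succ_of_ne, ih]
    rcases lab_eq_or i j n with h | h <;> rw [h] <;> assumption

theorem aSeq_succ (t : Seed I F) {i j : Mutable F} (hij : i ≠ j) (A : APos I) (n : ℕ) :
    t.aSeq i j A (n + 1) = t.aChart (alt i j n) A (lab i j (n + 1)) := by
  rw [aSeq, aChart_succ_of_ne]
  exact fun h => lab_ne hij n (Subtype.ext h.symm)

theorem prod_aChart_alt (t : Seed I F) {i j : Mutable F} (hij : i ≠ j) (A : APos I) (n : ℕ)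
    (e : I → ℤ) (he : e (lab i j n) = 0) :
    ((∏ k, t.aChart (alt i j n) A k ^ (e k).toNat : PosReal) : ℝ)
      = t.aSeq i j A (n + 1) ^ (e (lab i j (n + 1))).toNat * restMonomial i j A e := by
  have hc : ((∏ k, t.aChart (alt i j n) A k ^ (e k).toNat : PosReal) : ℝ)
      = ∏ k, (t.aChart (alt i j n) A k : ℝ) ^ (e k).toNat := by
    have : ∀ s : Finset I, ((∏ k ∈ s, t.aChart (alt i j n) A k ^ (e k).toNat : PosReal) : ℝ)
        = ∏ k ∈ s, (t.aChart (alt i j n) A k : ℝ) ^ (e k).toNat := by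
      intro s
      induction s using Finset.induction_on with
      | empty => simp
      | insert a s ha ih => rw [Finset.prod_insert ha, Finset.prod_insert ha, ← ih]; simp
    exact this _
  have hne : (lab i j n : I) ≠ lab i j (n + 1) := fun h => lab_ne hij n (Subtype.ext h)
  have hu : Finset.univ.filter (fun k : I => ¬ (k ≠ i ∧ k ≠ j))
      = {(lab i j n : I), (lab i j (n + 1) : I)} := by
    ext k
    by_cases h : Even n
    · simp [lab, h, Nat.even_add]; tauto
    · simp [lab, h, Nat.even_add]; tauto
  rw [hc, ← Finset.prod_filter_mul_prod_filter_not Finset.univ (fun k : I => k ≠ i ∧ k ≠ j),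
    mul_comm, hu, Finset.prod_pair hne, he, aSeq_succ t hij]
  congr 1
  · simp
  · refine Finset.prod_congr rfl fun k hk => ?_
    simp only [Finset.mem_filter, Finset.mem_univ, true_and] at hk
    rw [aChart_alt_of_ne t i j A n hk.1 hk.2]

/-- This is the exchange relation: the new variable is the one mutated again at time `n + 2`, the
only other variable of the pair is the one mutated at time `n + 1`, and the rest never change. -/
theorem aSeq_add_two (t : Seed I F) {i j : Mutable F} (hij : i ≠ j) (A : APos I) (n : ℕ) :
    t.aSeq i j A (n + 2) * t.aSeq i j A n
      = t.aSeq i j A (n + 1) ^ (-t.b j i).toNat * restMonomial i j A (t.row i j n)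
        + t.aSeq i j A (n + 1) ^ (t.b j i).toNat * restMonomial i j A (-t.row i j n) := by
  have h0 : t.row i j n (lab i j n) = 0 := b_self _ _
  have h1 := prod_aChart_alt t hij A n (t.row i j n) h0
  have h2 := prod_aChart_alt t hij A n (-t.row i j n) (by simp [h0])
  rw [row_lab_succ] at h1
  rw [Pi.neg_apply, row_lab_succ, neg_neg] at h2
  have h3 : t.aSeq i j A (n + 2) = (t.aSeq i j A n)⁻¹ *
      (((∏ k, t.aChart (alt i j n) A k ^ (t.row i j n k).toNat : PosReal) : ℝ)
        + ((∏ k, t.aChart (alt i j n) A k ^ ((-t.row i j n) k).toNat : PosReal) : ℝ)) := by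
    rw [aSeq_succ t hij, lab_add_two, alt, aChart]
    simp [aMut, aMutFun, aSeq, row]
  rw [h3, h1, h2]
  field_simp [(aSeq_pos t i j A n).ne']

theorem aChart_alt_eq_self (t : Seed I F) {i j : Mutable F} (hij : i ≠ j) (A : APos I) {n : ℕ}
    (hn : Even n) (h0 : t.aSeq i j A n = t.aSeq i j A 0)
    (h1 : t.aSeq i j A (n + 1) = t.aSeq i j A 1) : t.aChart (alt i j n) A = A := by
  funext k
  by_cases hi : k = i
  · subst hi
    apply Subtype.ext
    simpa [aSeq, lab_even _ _ hn, alt, aChart] using h0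
  by_cases hj : k = j
  · subst hj
    apply Subtype.ext
    rw [aSeq_succ t hij, aSeq_succ t hij, lab_odd _ _ (by simpa [Nat.even_add] using hn)] at h1
    simpa [alt, aChart] using h1
  exact aChart_alt_of_ne t i j A n hi hj

end ASide

/-! ### `X`-coordinates along an alternating sequence of mutations -/

/-- The logarithm of the `X`-coordinate with label `k` at time `n`. -/
noncomputable def xLog (t : Seed I F) (i j : Mutable F) (X : XPos F) (n : ℕ) (k : Mutable F) : ℝ :=
  Real.log (t.xChart (alt i j n) X k)

/-- The logarithm of `(1 + y ^ sgn e) ^ e`, as a function of `log y`. -/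
noncomputable def logFactor (v : ℝ) (e : ℤ) : ℝ :=
  e * Real.log (1 + Real.exp v) + max (-e : ℝ) 0 * v

/-- Rests on `log (1 + exp (-v)) = log (1 + exp v) - v`. It allows the orientation of the arrow to
be normalised. -/
theorem logFactor_neg (v : ℝ) (e : ℤ) : logFactor (-v) (-e) = -logFactor v e := by
  have h : Real.log (1 + Real.exp (-v)) = Real.log (1 + Real.exp v) - v := by
    have : 1 + Real.exp v = (1 + Real.exp (-v)) * Real.exp v := by
      rw [add_mul, ← Real.exp_add]; simp [add_comm]
    rw [this, Real.log_mul (by positivity) (by positivity), Real.log_exp]; ring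
  simp only [logFactor, h, Int.cast_neg, neg_neg]
  rcases le_total (0 : ℝ) e with he | he
  · rw [max_eq_left he, max_eq_right (by linarith)]; ring
  · rw [max_eq_right he, max_eq_left (by linarith)]; ring

theorem log_factor_eq (y : PosReal) (e : ℤ) :
    Real.log ((1 + y ^ e.sign) ^ e : PosReal) = logFactor (Real.log y) e := by
  have hy := y.2
  have hz (z : PosReal) (m : ℤ) : ((z ^ m : PosReal) : ℝ) = (z : ℝ) ^ m := by
    cases m with
    | ofNat m => simp
    | negSucc m => simp [zpow_negSucc]
  rw [hz, Real.log_zpow]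
  simp only [logFactor, Real.exp_log hy]
  rcases lt_trichotomy e 0 with he | he | he
  · have he' : (e : ℝ) < 0 := by exact_mod_cast he
    rw [max_eq_left (by linarith)]
    have h1 : ((1 + y ^ e.sign : PosReal) : ℝ) = (1 + (y : ℝ)) / y := by
      rw [Int.sign_eq_neg_one_of_neg he, Positive.coe_add, hz]
      field_simp
      simp [add_comm]
    rw [h1, Real.log_div (by positivity) hy.ne']
    ring
  · subst he; simp
  · have he' : (0 : ℝ) < e := by exact_mod_cast he
    rw [max_eq_right (by linarith), Int.sign_eq_one_of_pos he]
    simp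

/-- The logarithm of the `X`-coordinate that is mutated at time `n`, before this mutation. -/
noncomputable def xSeq (t : Seed I F) (i j : Mutable F) (X : XPos F) (n : ℕ) : ℝ :=
  t.xLog i j X n (lab i j n)

theorem xLog_lab (t : Seed I F) (i j : Mutable F) (X : XPos F) (n : ℕ) :
    t.xLog i j X (n + 1) (lab i j n) = -t.xSeq i j X n := by
  simp [xSeq, xLog, alt, xChart, xMut, xMutFun]

theorem xLog_succ (t : Seed I F) (i j : Mutable F) (X : XPos F) (n : ℕ) {k : Mutable F}
    (h : k ≠ lab i j n) :
    t.xLog i j X (n + 1) k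
      = t.xLog i j X n k + logFactor (t.xSeq i j X n) (t.row i j n k) := by
  simp only [xSeq, xLog]
  rw [← log_factor_eq, ← Real.log_mul (ne_of_gt (Subtype.prop _)) (ne_of_gt (Subtype.prop _))]
  simp [ alt, xChart, xMut, xMutFun, h, row]

theorem xSeq_succ (t : Seed I F) {i j : Mutable F} (hij : i ≠ j) (X : XPos F) (n : ℕ) :
    t.xSeq i j X (n + 1) = t.xLog i j X n (lab i j (n + 1))
      + logFactor (t.xSeq i j X n) (-t.b j i) := by
  rw [xSeq, xLog_succ t i j X n (lab_ne hij n).symm, row_lab_succ]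

theorem xSeq_add_two (t : Seed I F) {i j : Mutable F} (hij : i ≠ j) (X : XPos F) (n : ℕ) :
    t.xSeq i j X (n + 2) = -t.xSeq i j X n + logFactor (t.xSeq i j X (n + 1)) (-t.b j i) := by
  rw [xSeq_succ t hij, lab_add_two, xLog_lab]

theorem xChart_alt_eq_self (t : Seed I F) {i j : Mutable F} (hij : i ≠ j) (X : XPos F) {n : ℕ}
    (hn : Even n) (h0 : t.xSeq i j X n = t.xSeq i j X 0)
    (h1 : t.xSeq i j X (n + 1) = t.xSeq i j X 1)
    (h : ∀ k, k ≠ i → k ≠ j → t.xLog i j X n k = t.xLog i j X 0 k) :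
    t.xChart (alt i j n) X = X := by
  suffices H : ∀ k, t.xLog i j X n k = t.xLog i j X 0 k from
    funext fun k => Subtype.ext (Real.log_injOn_pos (Subtype.prop _) (Subtype.prop _) (H k))
  intro k
  by_cases hi : k = i
  · subst hi
    simpa [xSeq, lab_even _ _ hn] using h0
  by_cases hj : k = j
  · subst hj
    rw [xSeq_succ t hij, xSeq_succ t hij, h0, lab_odd _ _ (by simpa [Nat.even_add] using hn)] at h1
    simpa using h1
  exact h k hi hj

/-! ### Finite types: the square and the pentagon relation -/

/-- The pentagon recurrence with coefficients. -/
theorem pentagon_five {x P N : ℕ → ℝ} (hx : ∀ n, 0 < x n) (hP : ∀ n, 0 < P n)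
    (hN : ∀ n, 0 < N n) (hrec : ∀ n, x (n + 2) * x n = P n + x (n + 1) * N n)
    (hU : ∀ n, P (n + 2) * P n = P (n + 1) * N (n + 2) * N n)
    (hPN : ∀ n, N (n + 2) * N (n + 3) = P n) (n : ℕ) : x (n + 5) = x n := by
  have p2 : P (n + 2) * N (n + 3) = P (n + 1) * N n := by
    have := hU n
    rw [← hPN n] at this
    exact mul_right_cancel₀ (hN (n + 2)).ne' (by linear_combination this)
  have p3 : P (n + 3) = N n * N (n + 1) := by
    have : P (n + 3) * P (n + 1) = P (n + 2) * N (n + 3) * N (n + 1) := hU (n + 1)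
    exact mul_right_cancel₀ (hP (n + 1)).ne' (by linear_combination this + N (n + 1) * p2)
  have r0 := hrec n
  have r1 : x (n + 3) * x (n + 1) = P (n + 1) + x (n + 2) * N (n + 1) := hrec (n + 1)
  have r2 : x (n + 4) * x (n + 2) = P (n + 2) + x (n + 3) * N (n + 2) := hrec (n + 2)
  have r3 : x (n + 5) * x (n + 3) = P (n + 3) + x (n + 4) * N (n + 3) := hrec (n + 3)
  have hp := hPN n
  -- After multiplication by `x (n + 3) * x (n + 2)` the claim is a polynomial consequence of four
  -- consecutive exchange relations and the coefficient laws `p2`, `p3`, `hp`.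
  refine mul_right_cancel₀ (hx (n + 3)).ne' (mul_right_cancel₀ (hx (n + 2)).ne' ?_)
  linear_combination x (n + 2) * r3 + x (n + 2) * p3 + N (n + 3) * r2 + p2 - N n * r1
    - x (n + 3) * r0 + x (n + 3) * hp

/-- Logarithms of the pentagon recurrence. -/
theorem log_pentagon_five {v : ℕ → ℝ}
    (h : ∀ n, v (n + 2) + v n = Real.log (1 + Real.exp (v (n + 1)))) (n : ℕ) :
    v (n + 5) = v n := by
  have hx (n : ℕ) : Real.exp (v (n + 2)) * Real.exp (v n) = 1 + Real.exp (v (n + 1)) * 1 := by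
    rw [← Real.exp_add, h, Real.exp_log (by positivity), mul_one]
  have := pentagon_five (x := fun n => Real.exp (v n)) (P := fun _ => 1) (N := fun _ => 1)
    (fun n => Real.exp_pos _) (fun _ => one_pos) (fun _ => one_pos) hx (by simp) (by simp) n
  exact Real.exp_injective this

/-- The exponents satisfy the tropical form of the recurrence of `v`, so both sequences have period
five. Each term is then an increment of the discrete Wronskian `e n * v (n + 1) - e (n + 1) * v n`,
and the increments over a period cancel. -/
theorem sum_logFactor_pentagon {v : ℕ → ℝ} {e : ℕ → ℤ}
    (h : ∀ n, v (n + 2) + v n = Real.log (1 + Real.exp (v (n + 1))))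
    (he : ∀ n, e (n + 2) + e n = -max (-e (n + 1)) 0) (n : ℕ) :
    logFactor (v n) (e n) + logFactor (v (n + 1)) (e (n + 1)) + logFactor (v (n + 2)) (e (n + 2))
      + logFactor (v (n + 3)) (e (n + 3)) + logFactor (v (n + 4)) (e (n + 4)) = 0 := by
  have hm (m : ℕ) : max (-(e (m + 1)) : ℝ) 0 = -((e (m + 2) : ℝ) + e m) := by
    have := he m
    have h' : max (-e (m + 1)) 0 = -(e (m + 2) + e m) := by omega
    exact_mod_cast congrArg (Int.cast : ℤ → ℝ) h'
  have e5 (m : ℕ) : e (m + 5) = e m := by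
    have h0 := he m
    have h1 := he (m + 1)
    have h2 := he (m + 2)
    have h3 := he (m + 3)
    grind
  have hl (m : ℕ) : logFactor (v (m + 1)) (e (m + 1))
      = e (m + 1) * (v (m + 2) + v m) - ((e (m + 2) : ℝ) + e m) * v (m + 1) := by
    rw [logFactor, hm, h]; ring
  have h0 : logFactor (v n) (e n) = logFactor (v (n + 5)) (e (n + 5)) := by
    rw [e5, log_pentagon_five h]
  rw [h0, hl n, hl (n + 1), hl (n + 2), hl (n + 3), hl (n + 4)]
  have a5 := log_pentagon_five h n
  have a6 := log_pentagon_five h (n + 1)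
  have b5 := e5 n
  have b6 := e5 (n + 1)
  simp only [add_assoc, Nat.reduceAdd] at *
  rw [a5, a6, b5, b6]
  ring

/-! ### Relations for alternating words and powers of alternating loops -/

section

variable [Fintype I]

theorem chart_eq_one {t : Seed I F} {u : List (Mutable F)} (hA : ∀ A, t.aChart u A = A)
    (hX : ∀ X, t.xChart u X = X) : t.chart u = 1 :=
  Prod.ext (Equiv.ext fun A => by rw [chart_fst, hA]; rfl)
    (Equiv.ext fun X => by rw [chart_snd, hX]; rfl)

/-- Mutations in directions that are not joined by arrows commute. -/
theorem chart_alt_four (t : Seed I F) {i j : Mutable F} (hij : i ≠ j) (hb : t.b j i = 0) :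
    t.chart (alt i j 4) = 1 := by
  have hrow (n : ℕ) (k : I) (hi : k ≠ i) (hj : k ≠ j) :
      t.row i j (n + 2) k = -t.row i j n k := by
    have := row_add_two t hij n hi hj
    simp only [hb, abs_zero, zero_mul, add_zero] at this
    omega
  refine chart_eq_one (fun A => ?_) fun X => ?_
  · have hm (n : ℕ) (s : ℤ) : restMonomial i j A (fun k => s * t.row i j (n + 2) k)
        = restMonomial i j A (fun k => -(s * t.row i j n k)) := by
      refine Finset.prod_congr rfl fun k hk => ?_
      simp only [Finset.mem_filter, Finset.mem_univ, true_and] at hk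
      simp [hrow n k hk.1 hk.2]
    -- Reversing the sign of the row swaps the two exchange monomials, so the exchange relations at
    -- times `n` and `n + 2` have the same right-hand side.
    have hx (n : ℕ) : t.aSeq i j A (n + 4) = t.aSeq i j A n := by
      have h1 := aSeq_add_two t hij A n
      have h2 := aSeq_add_two t hij A (n + 2)
      have m1 := hm n 1
      have m2 := hm n (-1)
      simp only [one_mul, neg_mul, neg_neg] at m1 m2
      simp only [hb, neg_zero, Int.toNat_zero, pow_zero, one_mul] at h1 h2
      change _ = restMonomial i j A (fun k => t.row i j (n + 2) k) +
        restMonomial i j A (fun k => -t.row i j (n + 2) k) at h2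
      rw [m1, m2] at h2
      exact mul_right_cancel₀ (aSeq_pos t i j A (n + 2)).ne'
        (h2.trans ((add_comm _ _).trans (h1.symm.trans (mul_comm _ _))))
    exact aChart_alt_eq_self t hij A (by decide) (hx 0) (hx 1)
  · have hx (n : ℕ) : t.xSeq i j X (n + 2) = -t.xSeq i j X n := by
      rw [xSeq_add_two t hij, hb]; simp [logFactor]
    refine xChart_alt_eq_self t hij X (by decide) (by rw [hx, hx]; simp)
      (by rw [hx, hx]; simp) fun k hi hj => ?_
    have hk (n : ℕ) : k ≠ lab i j n := by
      rcases lab_eq_or i j n with h | h <;> rw [h] <;> assumption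
    have hi' : (k : I) ≠ i := fun h => hi (Subtype.ext h)
    have hj' : (k : I) ≠ j := fun h => hj (Subtype.ext h)
    have hs (n : ℕ) := xLog_succ t i j X n (hk n)
    rw [hs, hs, hs, hs, hx, hx, hrow 0 k hi' hj', hrow 1 k hi' hj', logFactor_neg, logFactor_neg]
    ring

/-- The pentagon relation. -/
theorem chart_alt_ten (t : Seed I F) {i j : Mutable F} (hij : i ≠ j)
    (hb : t.b j i = 1 ∨ t.b j i = -1) : t.chart (alt i j 10) = 1 := by
  have hdef (A : APos I) (e : I → ℤ) : restMonomial i j A e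
      = ∏ k ∈ Finset.univ.filter (fun k : I => k ≠ i ∧ k ≠ j), (A k : ℝ) ^ (e k).toNat := rfl
  -- The sign `s` of the arrow is absorbed into the rows, so both orientations obey one recurrence.
  obtain ⟨s, hs, hrow⟩ : ∃ s : ℤ, (s = 1 ∧ t.b j i = 1 ∨ s = -1 ∧ t.b j i = -1) ∧
      ∀ (n : ℕ) (k : I), k ≠ i → k ≠ j →
        s * t.row i j (n + 2) k + s * t.row i j n k = max (s * t.row i j (n + 1) k) 0 := by
    rcases hb with hb | hb
    · refine ⟨1, Or.inl ⟨rfl, hb⟩, fun n k hi hj => ?_⟩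
      have := row_add_two t hij n hi hj
      rw [hb] at this
      simp only [abs_one, one_mul] at *
      rcases abs_cases (t.row i j (n + 1) k) with h | h <;> omega
    · refine ⟨-1, Or.inr ⟨rfl, hb⟩, fun n k hi hj => ?_⟩
      have := row_add_two t hij n hi hj
      rw [hb] at this
      simp only [abs_neg, abs_one, one_mul] at *
      rcases abs_cases (t.row i j (n + 1) k) with h | h <;> omega
  refine chart_eq_one (fun A => ?_) fun X => ?_
  · have hx := pentagon_five (x := t.aSeq i j A)
      (P := fun n => restMonomial i j A (fun k => s * t.row i j n k))
      (N := fun n => restMonomial i j A (fun k => -(s * t.row i j n k)))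
      (aSeq_pos t i j A) (fun n => restMonomial_pos _ _ _ _) (fun n => restMonomial_pos _ _ _ _)
      (fun n => by
        have := aSeq_add_two t hij A n
        rcases hs with ⟨rfl, h⟩ | ⟨rfl, h⟩
        · simpa [h, Pi.neg_def] using this
        · simpa [h, Pi.neg_def, add_comm] using this)
      (fun n => by
        simp only [hdef, ← Finset.prod_mul_distrib, ← pow_add]
        refine Finset.prod_congr rfl fun k hk => ?_
        simp only [Finset.mem_filter, Finset.mem_univ, true_and] at hk
        have := hrow n k hk.1 hk.2
        congr 1
        omega)
      (fun n => by
        simp only [hdef, ← Finset.prod_mul_distrib, ← pow_add]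
        refine Finset.prod_congr rfl fun k hk => ?_
        simp only [Finset.mem_filter, Finset.mem_univ, true_and] at hk
        have h1 := hrow n k hk.1 hk.2
        have h2 := hrow (n + 1) k hk.1 hk.2
        simp only [add_assoc, Nat.reduceAdd] at h2
        congr 1
        omega)
    -- The sequence has period five, but five is odd and interchanges the two labels; the labelled
    -- chart returns after ten mutations.
    exact aChart_alt_eq_self t hij A (by decide) ((hx 5).trans (hx 0)) ((hx 6).trans (hx 1))
  · have hv (n : ℕ) : -s * t.xSeq i j X (n + 2) + -s * t.xSeq i j X n
        = Real.log (1 + Real.exp (-s * t.xSeq i j X (n + 1))) := by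
      have h1 : logFactor (-s * t.xSeq i j X (n + 1)) 1
          = -s * logFactor (t.xSeq i j X (n + 1)) (-t.b j i) := by
        rcases hs with ⟨rfl, h⟩ | ⟨rfl, h⟩
        · rw [h]; simpa using logFactor_neg (t.xSeq i j X (n + 1)) (-1)
        · rw [h]; simp
      have h2 : logFactor (-s * t.xSeq i j X (n + 1)) 1
          = Real.log (1 + Real.exp (-s * t.xSeq i j X (n + 1))) := by simp [logFactor]
      rw [← h2, h1, xSeq_add_two t hij]
      ring
    have hs0 : (-s : ℝ) ≠ 0 := by rcases hs with ⟨rfl, h⟩ | ⟨rfl, h⟩ <;> simp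
    have hx (n : ℕ) : t.xSeq i j X (n + 5) = t.xSeq i j X n :=
      mul_left_cancel₀ hs0 (log_pentagon_five (v := fun n => -s * t.xSeq i j X n) hv n)
    refine xChart_alt_eq_self t hij X (by decide) ((hx 5).trans (hx 0)) ((hx 6).trans (hx 1))
      fun k hi hj => ?_
    have hk (n : ℕ) : k ≠ lab i j n := by
      rcases lab_eq_or i j n with h | h <;> rw [h] <;> assumption
    have hi' : (k : I) ≠ i := fun h => hi (Subtype.ext h)
    have hj' : (k : I) ≠ j := fun h => hj (Subtype.ext h)
    have hstep (n : ℕ) := xLog_succ t i j X n (hk n)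
    have hf (n : ℕ) : logFactor (-s * t.xSeq i j X n) (-s * t.row i j n k)
        = -s * logFactor (t.xSeq i j X n) (t.row i j n k) := by
      rcases hs with ⟨rfl, h⟩ | ⟨rfl, h⟩
      · simpa using logFactor_neg (t.xSeq i j X n) (t.row i j n k)
      · simp
    have hsum (n : ℕ) : t.xLog i j X (n + 5) k = t.xLog i j X n k := by
      have := sum_logFactor_pentagon (v := fun n => -s * t.xSeq i j X n)
        (e := fun n => -s * t.row i j n k) hv
        (fun n => by have := hrow n k hi' hj'; simp only [neg_mul, neg_neg] at *; omega) n
      simp only [hf, ← mul_add] at this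
      have := (mul_eq_zero.1 this).resolve_left hs0
      rw [hstep (n + 4), hstep (n + 3), hstep (n + 2), hstep (n + 1), hstep n]
      linarith
    exact (hsum 5).trans (hsum 0)

/-- Relations that hold for all exchange matrices with a given entry can be repeated. -/
theorem chart_alt_mul (t : Seed I F) {i j : Mutable F} {p : ℕ} (hp : Even p)
    (h : ∀ t' : Seed I F, t'.b j i = t.b j i → t'.chart (alt i j p) = 1) (q : ℕ) :
    t.chart (alt i j (p * q)) = 1 := by
  induction q with
  | zero => simp [alt, chart]
  | succ q ih =>
    have he : Even (p * q) := hp.mul_right q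
    have ho : ¬ Even (p * q + 1) := by simpa [Nat.even_add] using he
    have hb := b_lab_succ_lab t i j (p * q)
    rw [lab_even _ _ he, lab_odd _ _ ho] at hb
    rw [mul_add, mul_one, add_comm, alt_add, chart_append, ih, lab_even _ _ he, lab_odd _ _ ho,
      h _ hb, one_mul]

/-- Powers of an alternating loop. -/
theorem chart_alt_pow (t : Seed I F) {i j : Mutable F} {p : ℕ} (hp : Even p)
    (h : t.seedAt (alt i j p) = t) (q : ℕ) :
    t.seedAt (alt i j (p * q)) = t ∧ t.chart (alt i j (p * q)) = t.chart (alt i j p) ^ q := by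
  induction q with
  | zero => simp [alt, chart, seedAt]
  | succ q ih =>
    have he : Even (p * q) := hp.mul_right q
    have ho : ¬ Even (p * q + 1) := by simpa [Nat.even_add] using he
    rw [mul_add, mul_one, add_comm, alt_add, chart_append, seedAt_append, lab_even _ _ he,
      lab_odd _ _ ho, ih.1, ih.2, pow_succ']
    exact ⟨h, rfl⟩

/-- An alternating loop in a rank-two reduction of finite type has finite order. -/
theorem isOfFinOrder_chart_alt (t : Seed I F) {i j : Mutable F} (hij : i ≠ j) {p : ℕ}
    (hp : Even p) (h : t.seedAt (alt i j p) = t) (hb : |t.b j i| ≤ 1) :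
    IsOfFinOrder (t.chart (alt i j p)) := by
  -- The `r`-th power of the loop of length `p` is the alternating word of length `p * r`, which is
  -- also the trivial word of length `r` repeated `p` times.
  have key (r : ℕ) (hr : 0 < r) (he : Even r)
      (H : ∀ t' : Seed I F, t'.b j i = t.b j i → t'.chart (alt i j r) = 1) :
      IsOfFinOrder (t.chart (alt i j p)) := by
    refine isOfFinOrder_iff_pow_eq_one.2 ⟨r, hr, ?_⟩
    rw [← (chart_alt_pow t hp h r).2, mul_comm]
    exact chart_alt_mul t he H p
  by_cases h0 : t.b j i = 0
  · exact key 4 (by norm_num) (by decide) fun t' h' => chart_alt_four t' hij (h'.trans h0)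
  · refine key 10 (by norm_num) (by decide) fun t' h' => chart_alt_ten t' hij ?_
    rw [h']
    rw [abs_le] at hb
    omega

end

/-! ### Periodic rows -/

/-- Summing the recurrence over a period gives `∑ (B * max d 0 - 2 * d) = 0`. As `B ≥ 2`, all terms
are nonnegative, hence zero, and the recurrence becomes `d (n + 2) + d n = 2 * d (n + 1)`. A
periodic arithmetic progression is constant, and the vanishing of one term gives the rest. -/
theorem eq_of_periodic_recurrence {d : ℕ → ℤ} {B : ℤ} (hB : 2 ≤ B)
    (h : ∀ n, d (n + 2) + d n = B * max (d (n + 1)) 0) {R : ℕ} (hR : 0 < R) (h0 : d R = d 0)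
    (h1 : d (R + 1) = d 1) : d 1 = d 0 ∧ 0 ≤ d 0 ∧ (B - 2) * d 0 = 0 := by
  have s1 : ∑ n ∈ Finset.range R, d (n + 1) = ∑ n ∈ Finset.range R, d n := by
    have := Finset.sum_range_succ d R
    rw [Finset.sum_range_succ'] at this
    linarith
  have s2 : ∑ n ∈ Finset.range R, d (n + 2) = ∑ n ∈ Finset.range R, d (n + 1) := by
    have := Finset.sum_range_succ (fun n => d (n + 1)) R
    rw [Finset.sum_range_succ'] at this
    linarith
  have hz : ∑ n ∈ Finset.range R, (B * max (d (n + 1)) 0 - 2 * d (n + 1)) = 0 := by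
    simp only [← h, Finset.sum_sub_distrib, Finset.sum_add_distrib, ← Finset.mul_sum]
    linarith
  rw [Finset.sum_eq_zero_iff_of_nonneg (fun n _ => by
    rcases le_total 0 (d (n + 1)) with h | h
    · rw [max_eq_left h]; nlinarith
    · rw [max_eq_right h]; linarith)] at hz
  have hlin (n : ℕ) (hn : n < R) : d (n + 2) - d (n + 1) = d (n + 1) - d n := by
    have := hz n (Finset.mem_range.2 hn)
    have := h n
    linarith
  have hdiff (n : ℕ) (hn : n ≤ R) : d (n + 1) - d n = d 1 - d 0 := by
    induction n with
    | zero => rfl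
    | succ n ih => rw [hlin n (by omega), ih (by omega)]
  have hsum : ∑ n ∈ Finset.range R, (d (n + 1) - d n) = R * (d 1 - d 0) := by
    rw [Finset.sum_congr rfl fun n hn => hdiff n (Finset.mem_range.1 hn).le]
    simp [mul_sub]
  rw [Finset.sum_range_sub, h0, sub_self] at hsum
  have h10 : d 1 = d 0 := by
    have hR' : (R : ℤ) ≠ 0 := by exact_mod_cast hR.ne'
    have := (mul_eq_zero.1 hsum.symm).resolve_left hR'
    linarith
  have hf := hz 0 (Finset.mem_range.2 hR)
  rw [zero_add, h10] at hf
  refine ⟨h10, ?_⟩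
  rcases le_total 0 (d 0) with h | h
  · rw [max_eq_left h] at hf
    exact ⟨h, by linarith⟩
  · rw [max_eq_right h] at hf
    have : d 0 = 0 := by linarith
    simp [this]

/-- The vertices `i`, `j` are joined by a double arrow, and every other vertex that is joined to
one of them spans an oriented cycle with them, so that the reduction to `i`, `j` is of affine type
and the exchange matrix is preserved by mutations at `i` and `j`. -/
def IsAffinePair (t : Seed I F) (i j : Mutable F) : Prop :=
  ∃ s : ℤ, (s = 1 ∨ s = -1) ∧ t.b j i = 2 * s ∧
    ∀ k : I, k ≠ i → k ≠ j → 0 ≤ s * t.b i k ∧ t.b j k = -t.b i k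

theorem IsAffinePair.symm {t : Seed I F} {i j : Mutable F} (h : t.IsAffinePair i j) :
    t.IsAffinePair j i := by
  obtain ⟨s, hs, hb, hk⟩ := h
  refine ⟨-s, by omega, by rw [b_skew, hb]; ring, fun k hj hi => ?_⟩
  obtain ⟨h1, h2⟩ := hk k hi hj
  rw [h2]
  exact ⟨by linarith, by ring⟩

/-- The closed loop makes every row sequence periodic, so `eq_of_periodic_recurrence` applies with
`B = |t.b j i|`. If `B > 2`, all arrows from the pair to other vertices would vanish, which `hc`
excludes. -/
theorem isAffinePair_of_seedAt_alt_eq (t : Seed I F) {i j : Mutable F} (hij : i ≠ j) {R : ℕ}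
    (hR : 0 < R) (hE : Even R) (h : t.seedAt (alt i j R) = t) (hb : 2 ≤ |t.b j i|)
    (hc : |t.b j i| = 2 ∨ ∃ k : I, k ≠ i ∧ k ≠ j ∧ (t.b i k ≠ 0 ∨ t.b j k ≠ 0)) :
    t.IsAffinePair i j := by
  have hO : ¬ Even (R + 1) := by simpa [Nat.even_add] using hE
  obtain ⟨s, hs, hsb⟩ : ∃ s : ℤ, (s = 1 ∨ s = -1) ∧ t.b j i = s * |t.b j i| := by
    rcases abs_cases (t.b j i) with h | h
    · exact ⟨1, Or.inl rfl, by linarith⟩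
    · exact ⟨-1, Or.inr rfl, by linarith⟩
  have hss : s * s = 1 := by rcases hs with rfl | rfl <;> norm_num
  have habs (a : ℤ) :
      |t.b j i| * a + s * |t.b j i| * |a| = 2 * (s * (|t.b j i| * max (s * a) 0)) := by
    rcases hs with rfl | rfl <;> rcases le_total 0 a with h | h
    · rw [abs_of_nonneg h, max_eq_left (by linarith)]; ring
    · rw [abs_of_nonpos h, max_eq_right (by linarith)]; ring
    · rw [abs_of_nonneg h, max_eq_right (by linarith)]; ring
    · rw [abs_of_nonpos h, max_eq_left (by linarith)]; ring
  have main (k : I) (hi : k ≠ i) (hj : k ≠ j) :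
      0 ≤ s * t.b i k ∧ (|t.b j i| - 2) * (s * t.b i k) = 0 ∧
      t.b j k = (1 - |t.b j i|) * t.b i k := by
    have r0 : t.row i j 0 k = t.b i k := by simp [row, alt, seedAt]
    have rR : t.row i j R k = t.row i j 0 k := by
      rw [row, h, lab_even _ _ hE, r0]
    have rR1 : t.row i j (R + 1) k = t.row i j 1 k := by
      rw [row, add_comm R 1, alt_add, seedAt_append, h, add_comm 1 R, lab_even _ _ hE,
        lab_odd _ _ hO, row, lab_one]
    have r1 : t.row i j 1 k = t.b j k + s * (|t.b j i| * max (s * t.b i k) 0) := by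
      have := row_succ t hij 0 hi hj
      rw [r0] at this
      simp only [zero_add, lab_one, alt, seedAt] at this
      have h2 := habs (t.b i k)
      rw [← hsb] at h2
      linarith
    obtain ⟨h1, h2, h3⟩ := eq_of_periodic_recurrence (d := fun n => s * t.row i j n k)
      (B := |t.b j i|) hb (fun n => by
        have h1 := row_add_two t hij n hi hj
        have h2 := habs (t.row i j (n + 1) k)
        rw [← hsb] at h2
        have h3 : t.row i j (n + 2) k + t.row i j n k
            = s * (|t.b j i| * max (s * t.row i j (n + 1) k) 0) := by linarith
        rw [← mul_add, h3, ← mul_assoc, hss, one_mul]) hR (by simp only [rR])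
        (by simp only [rR1])
    simp only [r0] at h1 h2 h3
    refine ⟨h2, h3, ?_⟩
    rw [r1, max_eq_left h2] at h1
    have h4 : s * (s * (t.b j k + s * (|t.b j i| * (s * t.b i k)))) = s * (s * t.b i k) := by
      rw [h1]
    linear_combination h4 + (t.b i k - t.b j k - |t.b j i| * t.b i k * (s * s + 1)) * hss
  have hb2 : |t.b j i| = 2 := by
    rcases hc with hc | ⟨k, hi, hj, hk⟩
    · exact hc
    · obtain ⟨-, h2, h3⟩ := main k hi hj
      have hik : t.b i k ≠ 0 := by
        intro h0
        rw [h0, mul_zero] at h3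
        tauto
      have hs0 : s ≠ 0 := by rintro rfl; simp at hss
      have := (mul_eq_zero.1 h2).resolve_right (mul_ne_zero hs0 hik)
      linarith
  refine ⟨s, hs, by rw [hsb, hb2]; ring, fun k hi hj => ?_⟩
  obtain ⟨h1, -, h3⟩ := main k hi hj
  exact ⟨h1, by rw [h3, hb2]; ring⟩

/-- In an affine pair, the rows of the mutated vertices are constant. -/
theorem IsAffinePair.row_eq {t : Seed I F} {i j : Mutable F} (hij : i ≠ j)
    (h : t.IsAffinePair i j) {k : I} (hi : k ≠ i) (hj : k ≠ j) (n : ℕ) :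
    t.row i j n k = t.b i k := by
  obtain ⟨s, hs, hb, hk⟩ := h
  obtain ⟨h1, h2⟩ := hk k hi hj
  -- With the sign condition of an affine pair the piecewise linear term is linear, and a constant
  -- row solves the recurrence.
  have key : |t.b j i| * t.b i k + t.b j i * |t.b i k| = 4 * t.b i k := by
    rw [hb]
    rcases hs with rfl | rfl
    · rw [abs_of_nonneg (show 0 ≤ t.b i k by linarith)]; norm_num; ring
    · rw [abs_of_nonpos (show t.b i k ≤ 0 by linarith)]; norm_num; ring
  have r0 : t.row i j 0 k = t.b i k := by simp [row, alt, seedAt]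
  have H (n : ℕ) : t.row i j n k = t.b i k ∧ t.row i j (n + 1) k = t.b i k := by
    induction n with
    | zero =>
      refine ⟨r0, ?_⟩
      have := row_succ t hij 0 hi hj
      rw [r0, key] at this
      simp only [zero_add, lab_one, alt, seedAt] at this
      linarith
    | succ n ih =>
      refine ⟨ih.2, ?_⟩
      have := row_add_two t hij n hi hj
      rw [ih.1, ih.2, key] at this
      linarith
  exact (H n).1

/-! ### Connectedness -/

/-- Mutation can cancel the edge `a b` only if `a` and `b` are both joined to `k`, and the edges at
`k` survive. -/
theorem mutate_isConnected {s : Seed I F} (h : s.IsConnected) (k : Mutable F) :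
    (s.mutate k).IsConnected := by
  have hadj (a b : I) (hab : s.ε a b ≠ 0) : (s.mutate k).graph.Reachable a b := by
    by_cases h' : (s.mutate k).ε a b = 0
    · have hk : ¬ (a = k ∨ b = k) := by
        intro hk
        simp only [mutate, if_pos hk, neg_eq_zero] at h'
        exact hab h'
      have h1 : s.ε a k ≠ 0 := by
        intro h0
        simp only [mutate, if_neg hk, h0] at h'
        simp at h'; exact hab h'
      have h2 : s.ε k b ≠ 0 := by
        intro h0
        simp only [mutate, if_neg hk, h0] at h'
        simp at h'; exact hab h'
      have e1 : (s.mutate k).graph.Adj a k := by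
        change (s.mutate k).ε a k ≠ 0
        simpa [mutate] using h1
      have e2 : (s.mutate k).graph.Adj k b := by
        change (s.mutate k).ε k b ≠ 0
        simpa [mutate] using h2
      exact e1.reachable.trans e2.reachable
    · exact SimpleGraph.Adj.reachable (G := (s.mutate k).graph) h'
  have hn : Nonempty I := h.nonempty
  refine ⟨fun a b => ?_⟩
  obtain ⟨p⟩ := h.preconnected a b
  induction p with
  | nil => exact SimpleGraph.Reachable.refl _
  | cons e p ih => exact (hadj _ _ e).trans ih

theorem seedAt_isConnected {s : Seed I F} (h : s.IsConnected) (w : List (Mutable F)) :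
    (s.seedAt w).IsConnected := by
  induction w with
  | nil => exact h
  | cons k w ih => exact mutate_isConnected ih k

/-- Otherwise no walk leaves `{i, j}`, and the mutable rank is at most two. The vertex found may be
frozen. -/
theorem exists_b_ne_zero_of_isConnected {t : Seed I F} (h : t.IsConnected)
    (hF : 3 ≤ mutableRank F) (i j : Mutable F) :
    ∃ k : I, k ≠ i ∧ k ≠ j ∧ (t.b i k ≠ 0 ∨ t.b j k ≠ 0) := by
  classical
  by_contra! hcon
  have hreach (x : I) : x = i ∨ x = j := by
    obtain ⟨p⟩ := h.preconnected (i : I) x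
    have H : ∀ {a b : I}, t.graph.Walk a b → (a = i ∨ a = j) → (b = i ∨ b = j) := by
      intro a b p
      induction p with
      | nil => exact id
      | @cons a c b e p ih =>
        intro ha
        refine ih ?_
        by_contra! hc
        obtain ⟨h1, h2⟩ := hcon c hc.1 hc.2
        have e' : t.ε a c ≠ 0 := e
        rcases ha with rfl | rfl
        · rw [← cast_b, h1] at e'; simp at e'
        · rw [← cast_b, h2] at e'; simp at e'
    exact H p (Or.inl rfl)
  have hcov : (Set.univ : Set (Mutable F)) ⊆ {i, j} := by
    intro x _
    rcases hreach x with h | h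
    · exact Or.inl (Subtype.ext h)
    · exact Or.inr (Subtype.ext h)
  have := Set.ncard_le_ncard hcov
  rw [Set.ncard_univ] at this
  have h2 := Set.ncard_insert_le i {j}
  rw [Set.ncard_singleton] at h2
  unfold mutableRank at hF
  omega

theorem abs_seedAt_of_isTypeL {s : Seed I F} {m : ℕ} (h : s.IsTypeL m) (w : List (Mutable F))
    {a b : I} (hab : a ≠ b) : |(s.seedAt w).ε a b| = m := by
  obtain ⟨-, x, y, hxy, hc, hε⟩ := h
  induction w with
  | nil =>
    rw [seedAt]
    rcases hc a with rfl | rfl <;> rcases hc b with rfl | rfl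
    · exact absurd rfl hab
    · simp [hε]
    · rw [s.skew, hε]; simp
    · exact absurd rfl hab
  | cons k w ih =>
    have : a = k ∨ b = k := by
      rcases hc a with rfl | rfl <;> rcases hc b with rfl | rfl <;> rcases hc k with h | h <;>
        simp_all
    rw [seedAt, mutate]
    simp only [if_pos this, abs_neg, ih]

end Seed

open Filter Topology

/-! ### The recurrence of affine type -/

/-- Subtracting consecutive relations eliminates `K` and shows that `(x (n + 2) + x n) / x (n + 1)`
is conserved. -/
theorem exists_const_of_affine_recurrence {x : ℕ → ℝ} {K : ℝ} (hx : ∀ n, 0 < x n)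
    (h : ∀ n, x (n + 2) * x n = x (n + 1) ^ 2 + K) :
    ∃ T : ℝ, ∀ n, x (n + 2) + x n = T * x (n + 1) := by
  refine ⟨(x 2 + x 0) / x 1, fun n => ?_⟩
  induction n with
  | zero => field_simp [(hx 1).ne']
  | succ n ih =>
    have h1 := h n
    have h2 : x (n + 3) * x (n + 1) = x (n + 2) ^ 2 + K := h (n + 1)
    refine mul_right_cancel₀ (hx (n + 1)).ne' ?_
    change (x (n + 3) + x (n + 1)) * x (n + 1) = _ * x (n + 2) * x (n + 1)
    linear_combination h2 - h1 + x (n + 2) * ih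

/-- The linear recurrence bounds ratios of neighbours by `T` in both directions. The ratios increase
by `K / (x (n + 1) * x (n + 2))`; being bounded they converge, so these increments tend to zero and
the products tend to infinity. -/
theorem log_of_affine_recurrence {x : ℕ → ℝ} {K : ℝ} (hK : 0 < K) (hx : ∀ n, 0 < x n)
    (h : ∀ n, x (n + 2) * x n = x (n + 1) ^ 2 + K) :
    Tendsto (fun n => Real.log (x n)) atTop atTop ∧
      ∃ C, ∀ n, |Real.log (x (n + 2)) - Real.log (x (n + 1))| ≤ C := by
  obtain ⟨T, hT⟩ := exists_const_of_affine_recurrence hx h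
  have hT0 : 0 < T := by
    have h0 := hT 0
    have h1 := hx 0
    have h2 := hx 2
    have : 0 < T * x 1 := by rw [← h0]; positivity
    exact pos_of_mul_pos_left this (hx 1).le
  have hup (n : ℕ) : x (n + 2) ≤ T * x (n + 1) := by linarith [hT n, hx n]
  have hlo (n : ℕ) : x n ≤ T * x (n + 1) := by linarith [hT n, hx (n + 2)]
  have hdiff (n : ℕ) : |Real.log (x (n + 2)) - Real.log (x (n + 1))| ≤ Real.log T := by
    have h1 := Real.log_le_log (hx _) (hup n)
    have h2 := Real.log_le_log (hx _) (hlo (n + 1))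
    rw [Real.log_mul hT0.ne' (hx _).ne'] at h1 h2
    rw [abs_le]
    constructor <;> linarith
  set r : ℕ → ℝ := fun n => x (n + 2) / x (n + 1) with hr
  have hstep (n : ℕ) : r (n + 1) - r n = K / (x (n + 1) * x (n + 2)) := by
    have h1 := h (n + 1)
    have p1 := hx (n + 1)
    have p2 := hx (n + 2)
    simp only [hr]
    change x (n + 3) / x (n + 2) - _ = _
    rw [div_sub_div _ _ p2.ne' p1.ne', mul_comm (x (n + 2)) (x (n + 1))]
    congr 1
    change x (n + 3) * x (n + 1) = x (n + 2) ^ 2 + K at h1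
    linarith
  have hmono : Monotone r := monotone_nat_of_le_succ fun n => by
    have : 0 < K / (x (n + 1) * x (n + 2)) := by
      have p1 := hx (n + 1)
      have p2 := hx (n + 2)
      positivity
    linarith [hstep n]
  have hbdd : BddAbove (Set.range r) := ⟨T, by
    rintro _ ⟨n, rfl⟩
    simp only [hr]
    rw [div_le_iff₀ (hx _)]
    exact hup n⟩
  have hlim := tendsto_atTop_ciSup hmono hbdd
  have hzero : Tendsto (fun n => r (n + 1) - r n) atTop (𝓝 0) := by
    simpa using (hlim.comp (tendsto_add_atTop_nat 1)).sub hlim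
  have hprod : Tendsto (fun n => x (n + 1) * x (n + 2)) atTop atTop := by
    have h1 : Tendsto (fun n => (r (n + 1) - r n) / K) atTop (𝓝[>] 0) := by
      refine tendsto_nhdsWithin_iff.2 ⟨by simpa using hzero.div_const K,
        Eventually.of_forall fun n => ?_⟩
      have p1 := hx (n + 1)
      have p2 := hx (n + 2)
      rw [hstep]
      exact Set.mem_Ioi.2 (by positivity)
    refine (tendsto_inv_nhdsGT_zero.comp h1).congr fun n => ?_
    simp only [Function.comp, hstep]
    field_simp
  refine ⟨?_, Real.log T, hdiff⟩
  rw [← tendsto_add_atTop_iff_nat 1]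
  have hlog := Real.tendsto_log_atTop.comp hprod
  -- Neighbouring logarithms differ by at most `log T`, so each is at least half of their sum minus
  -- `log T`.
  have h2 : Tendsto (fun n => (Real.log (x (n + 1) * x (n + 2)) - Real.log T) / 2) atTop atTop :=
    (tendsto_atTop_add_const_right _ (-Real.log T) hlog).atTop_div_const two_pos
  refine tendsto_atTop_mono (fun n => ?_) h2
  rw [Real.log_mul (hx _).ne' (hx _).ne']
  have := (abs_le.1 (hdiff n)).2
  linarith

/-! ### Asymptotic directions -/

/-- The sequence `u` stays at bounded distance from the ray spanned by `G` and diverges along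
it. -/
def AsymptoticTo {I : Type*} [Fintype I] (u : ℕ → I → ℝ) (G : I → ℝ) : Prop :=
  ∃ L : ℕ → ℝ, Tendsto L atTop atTop ∧ ∃ C, ∀ᶠ m in atTop, ‖u m - L m • G‖ ≤ C

/-- Division by `L m` turns the bounded error into a null sequence, and the radial coordinate
becomes `((L m)⁻¹ + ‖v‖)⁻¹ • v` with `v = (L m)⁻¹ • u m` tending to `G`. -/
theorem AsymptoticTo.tendsto {I : Type*} [Fintype I] {u : ℕ → I → ℝ} {G : I → ℝ}
    (h : AsymptoticTo u G) (hG : G ≠ 0) :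
    Tendsto (fun m => (1 + ‖u m‖)⁻¹ • u m) atTop (𝓝 (‖G‖⁻¹ • G)) := by
  obtain ⟨L, hL, C, hC⟩ := h
  have hinv : Tendsto (fun m => (L m)⁻¹) atTop (𝓝 0) := tendsto_inv_atTop_zero.comp hL
  have hpos : ∀ᶠ m in atTop, 0 < L m := hL.eventually_gt_atTop 0
  have h1 : Tendsto (fun m => (L m)⁻¹ • u m) atTop (𝓝 G) := by
    rw [tendsto_iff_norm_sub_tendsto_zero]
    refine squeeze_zero' (Eventually.of_forall fun m => norm_nonneg _) ?_
      (by simpa using hinv.mul_const C)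
    filter_upwards [hC, hpos] with m hm hp
    have : (L m)⁻¹ • u m - G = (L m)⁻¹ • (u m - L m • G) := by
      rw [smul_sub, smul_smul, inv_mul_cancel₀ hp.ne', one_smul]
    rw [this, norm_smul, Real.norm_of_nonneg (inv_pos.2 hp).le]
    exact mul_le_mul_of_nonneg_left hm (inv_pos.2 hp).le
  have h2 : Tendsto (fun m => ((L m)⁻¹ + ‖(L m)⁻¹ • u m‖)⁻¹) atTop (𝓝 ‖G‖⁻¹) := by
    have := hinv.add h1.norm
    rw [zero_add] at this
    exact this.inv₀ (norm_ne_zero_iff.2 hG)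
  refine (h2.smul h1).congr' ?_
  filter_upwards [hpos] with m hp
  rw [smul_smul, norm_smul, Real.norm_of_nonneg (inv_pos.2 hp).le]
  congr 1
  have : 0 ≤ ‖u m‖ := norm_nonneg _
  field_simp

theorem tendsto_of_residues {X : Type*} {v : ℕ → X} {l : Filter X} {N : ℕ} (hN : 0 < N)
    (h : ∀ r, Tendsto (fun q => v (N * q + r)) atTop l) : Tendsto v atTop l := by
  intro U hU
  have h1 : ∀ r, ∃ q0, ∀ q ≥ q0, v (N * q + r) ∈ U := fun r =>
    eventually_atTop.1 (h r hU)
  choose q0 hq0 using h1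
  refine eventually_atTop.2 ⟨N * ((Finset.range N).sup q0), fun m hm => ?_⟩
  have hr : m % N < N := Nat.mod_lt _ hN
  have := hq0 (m % N) (m / N) ((Finset.le_sup (Finset.mem_range.2 hr)).trans
    ((Nat.le_div_iff_mul_le hN).2 (by rwa [mul_comm])))
  rwa [Nat.div_add_mod] at this

namespace Seed

variable {I : Type*} [DecidableEq I] {F : Finset I} [Fintype I]

/-! ### The tropical charts -/

theorem tropMut_of_ne (s : Seed I F) (k : Mutable F) (a : ATrop I) {i : I} (h : i ≠ k) :
    s.tropMut k a i = a i := if_neg h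

theorem sum_mul_congr_of_ne {k : I} {c : I → ℝ} (hc : c k = 0) {a a' : I → ℝ}
    (h : ∀ i, i ≠ k → a i = a' i) : ∑ j, c j * a j = ∑ j, c j * a' j := by
  refine Finset.sum_congr rfl fun j _ => ?_
  by_cases hj : j = k
  · rw [hj, hc]; simp
  · rw [h j hj]

theorem tropMut_mutate (s : Seed I F) (k : Mutable F) (a : ATrop I) :
    (s.mutate k).tropMut k (s.tropMut k a) = a := by
  funext i
  by_cases h : i = k
  · subst h
    rw [tropMut, if_pos rfl]
    simp only [mutate_b, neg_neg]
    rw [sum_mul_congr_of_ne (k := (k : I)) (by simp [b_self]) fun i hi => tropMut_of_ne s k a hi,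
      sum_mul_congr_of_ne (k := (k : I)) (by simp [b_self]) fun i hi => tropMut_of_ne s k a hi,
      tropMut, if_pos rfl, max_comm]
    ring
  · rw [tropMut_of_ne _ _ _ h, tropMut_of_ne _ _ _ h]

theorem tropChart_append (s : Seed I F) (u v : List (Mutable F)) (G : ATrop I) :
    s.tropChart (u ++ v) G = (s.seedAt v).tropChart u (s.tropChart v G) := by
  induction u with
  | nil => rfl
  | cons k u ih => simp [tropChart, ih, seedAt_append]

theorem tropChart_reverse (s : Seed I F) (u : List (Mutable F)) (G : ATrop I) :
    (s.seedAt u).tropChart u.reverse (s.tropChart u G) = G := by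
  induction u with
  | nil => rfl
  | cons k u ih =>
    simp [seedAt, tropChart, tropChart_append, mutate_mutate, tropMut_mutate, ih]

theorem tropChart_zero (s : Seed I F) (u : List (Mutable F)) : s.tropChart u 0 = 0 := by
  induction u with
  | nil => rfl
  | cons k u ih =>
    funext i
    simp [tropChart, tropMut, ih]

theorem tropChart_ne_zero (s : Seed I F) (u : List (Mutable F)) {G : ATrop I} (hG : G ≠ 0) :
    s.tropChart u G ≠ 0 := by
  intro h
  have := tropChart_reverse s u G
  rw [h, tropChart_zero] at this
  exact hG this.symm

/-- The vector of the logarithms of the coordinates. -/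
noncomputable def logVec (g : APos I) : I → ℝ := fun i => Real.log (g i)

theorem log_prod_pow (A : APos I) (e : I → ℕ) :
    Real.log ((∏ j, A j ^ e j : PosReal) : ℝ) = ∑ j, (e j : ℝ) * logVec A j := by
  have : ∀ s : Finset I, Real.log ((∏ j ∈ s, A j ^ e j : PosReal) : ℝ)
      = ∑ j ∈ s, (e j : ℝ) * logVec A j := by
    intro s
    induction s using Finset.induction_on with
    | empty => simp
    | insert a s ha ih =>
      rw [Finset.prod_insert ha, Finset.sum_insert ha, ← ih, Positive.val_mul,
        Real.log_mul (ne_of_gt (Subtype.prop _)) (ne_of_gt (Subtype.prop _))]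
      simp [logVec]
  exact this _

theorem abs_log_add_sub_max_le {p q : ℝ} (hp : 0 < p) (hq : 0 < q) :
    |Real.log (p + q) - max (Real.log p) (Real.log q)| ≤ Real.log 2 := by
  wlog h : q ≤ p generalizing p q
  · rw [add_comm, max_comm]
    exact this hq hp (not_le.1 h).le
  rw [max_eq_left (Real.log_le_log hq h), abs_le]
  have h1 : Real.log p ≤ Real.log (p + q) := Real.log_le_log hp (by linarith)
  have h2 : Real.log (p + q) ≤ Real.log (2 * p) := Real.log_le_log (by linarith) (by linarith)
  rw [Real.log_mul two_ne_zero hp.ne'] at h2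
  have h3 := Real.log_pos one_lt_two
  constructor <;> linarith

/-- Only one coordinate differs, and there the logarithm of a sum of two terms is compared with the
maximum of their logarithms. The bound is uniform in the point. -/
theorem norm_logVec_aMut_sub_le (s : Seed I F) (k : Mutable F) (A : APos I) :
    ‖logVec (s.aMut k A) - s.tropMut k (logVec A)‖ ≤ Real.log 2 := by
  have h2 := Real.log_pos one_lt_two
  refine (pi_norm_le_iff_of_nonneg h2.le).2 fun i => ?_
  rw [Pi.sub_apply, Real.norm_eq_abs]
  by_cases h : i = k
  · have e1 : logVec (s.aMut k A) i = -logVec A k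
        + Real.log (((∏ j, A j ^ (s.b k j).toNat : PosReal) : ℝ)
          + ((∏ j, A j ^ (-s.b k j).toNat : PosReal) : ℝ)) := by
      rw [← Positive.coe_add]
      simp only [logVec, aMut, Equiv.coe_fn_mk, aMutFun, h, if_true]
      rw [Positive.val_mul,
        Real.log_mul (ne_of_gt (Subtype.prop _)) (ne_of_gt (Subtype.prop _)), Positive.coe_inv,
        Real.log_inv]
    have e2 : s.tropMut k (logVec A) i = -logVec A k
        + max (Real.log ((∏ j, A j ^ (s.b k j).toNat : PosReal) : ℝ))
          (Real.log ((∏ j, A j ^ (-s.b k j).toNat : PosReal) : ℝ)) := by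
      rw [log_prod_pow, log_prod_pow, tropMut, if_pos h]
    rw [e1, e2, add_sub_add_left_eq_sub]
    exact abs_log_add_sub_max_le (Subtype.prop _) (Subtype.prop _)
  · rw [tropMut_of_ne _ _ _ h]
    simp [logVec, aMut, aMutFun, h, h2.le]

theorem abs_sum_mul_sub_le (c : I → ℕ) (a a' : I → ℝ) :
    |∑ j, (c j : ℝ) * a j - ∑ j, (c j : ℝ) * a' j| ≤ (∑ j, (c j : ℝ)) * ‖a - a'‖ := by
  rw [← Finset.sum_sub_distrib, Finset.sum_mul]
  refine (Finset.abs_sum_le_sum_abs _ _).trans (Finset.sum_le_sum fun j _ => ?_)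
  rw [← mul_sub, abs_mul, abs_of_nonneg (Nat.cast_nonneg _)]
  exact mul_le_mul_of_nonneg_left (norm_le_pi_norm (a - a') j) (Nat.cast_nonneg _)

theorem exists_tropMut_lipschitz (s : Seed I F) (k : Mutable F) :
    ∃ K : ℝ, 0 ≤ K ∧ ∀ a a', ‖s.tropMut k a - s.tropMut k a'‖ ≤ K * ‖a - a'‖ := by
  set P := ∑ j, ((s.b k j).toNat : ℝ) with hP
  set N := ∑ j, ((-s.b k j).toNat : ℝ) with hN
  have hP0 : 0 ≤ P := Finset.sum_nonneg fun j _ => Nat.cast_nonneg _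
  have hN0 : 0 ≤ N := Finset.sum_nonneg fun j _ => Nat.cast_nonneg _
  refine ⟨1 + P + N, by positivity, fun a a' => ?_⟩
  have hn := norm_nonneg (a - a')
  refine (pi_norm_le_iff_of_nonneg (by positivity)).2 fun i => ?_
  rw [Pi.sub_apply, Real.norm_eq_abs]
  have hi (i : I) : |a i - a' i| ≤ ‖a - a'‖ := norm_le_pi_norm (a - a') i
  by_cases h : i = k
  · simp only [tropMut, h, if_true]
    have h1 := abs_sum_mul_sub_le (fun j => (s.b k j).toNat) a a'
    have h2 := abs_sum_mul_sub_le (fun j => (-s.b k j).toNat) a a'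
    have h3 := abs_max_sub_max_le_max (∑ j, ((s.b k j).toNat : ℝ) * a j)
      (∑ j, ((-s.b k j).toNat : ℝ) * a j) (∑ j, ((s.b k j).toNat : ℝ) * a' j)
      (∑ j, ((-s.b k j).toNat : ℝ) * a' j)
    have h4 := hi k
    rw [← hP] at h1
    rw [← hN] at h2
    have h5 : P * ‖a - a'‖ ≤ (P + N) * ‖a - a'‖ := by gcongr; linarith
    have h6 : N * ‖a - a'‖ ≤ (P + N) * ‖a - a'‖ := by gcongr; linarith
    have h7 := h3.trans (max_le (h1.trans h5) (h2.trans h6))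
    rw [abs_le] at h4 h7 ⊢
    constructor <;> nlinarith
  · rw [tropMut_of_ne _ _ _ h, tropMut_of_ne _ _ _ h]
    refine (hi i).trans ?_
    nlinarith

/-- The mutation is uniformly close to its tropical limit, which is Lipschitz and commutes with
positive scaling, so the distance to the image ray remains bounded with the same `L`. -/
theorem asymptoticTo_aMut (s : Seed I F) (k : Mutable F) {u : ℕ → APos I} {G : ATrop I}
    (h : AsymptoticTo (fun m => logVec (u m)) G) :
    AsymptoticTo (fun m => logVec (s.aMut k (u m))) (s.tropMut k G) := by
  obtain ⟨L, hL, C, hC⟩ := h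
  obtain ⟨K, hK, hlip⟩ := exists_tropMut_lipschitz s k
  refine ⟨L, hL, Real.log 2 + K * C, ?_⟩
  filter_upwards [hC, hL.eventually_gt_atTop 0] with m hm hp
  have h1 : L m • s.tropMut k G = s.tropMut k (L m • G) :=
    (tropChart_smul s [k] hp G).symm
  rw [h1]
  refine (norm_sub_le_norm_sub_add_norm_sub _ (s.tropMut k (logVec (u m))) _).trans ?_
  exact add_le_add (norm_logVec_aMut_sub_le s k _)
    ((hlip _ _).trans (mul_le_mul_of_nonneg_left hm hK))

theorem asymptoticTo_aChart (s : Seed I F) (w : List (Mutable F)) {u : ℕ → APos I} {G : ATrop I}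
    (h : AsymptoticTo (fun m => logVec (u m)) G) :
    AsymptoticTo (fun m => logVec (s.aChart w (u m))) (s.tropChart w G) := by
  induction w with
  | nil => exact h
  | cons k w ih => exact asymptoticTo_aMut _ k ih

theorem asymptoticTo_of_aChart (s : Seed I F) (w : List (Mutable F)) {u : ℕ → APos I}
    {G : ATrop I} (h : AsymptoticTo (fun m => logVec (s.aChart w (u m))) (s.tropChart w G)) :
    AsymptoticTo (fun m => logVec (u m)) G := by
  have := asymptoticTo_aChart (s.seedAt w) w.reverse h
  rw [tropChart_reverse] at this
  convert this using 3 with m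
  rw [← chart_fst, ← chart_fst, chart_reverse]
  simp

theorem convergesTo_iff (s : Seed I F) (u : ℕ → APos I) {G : ATrop I} (hG : G ≠ 0) :
    s.ConvergesTo u (rayOfNeZero ℝ G hG) ↔ ∀ w : Simplex F,
      Tendsto (fun m => (1 + ‖logVec (s.aChart w.1 (u m))‖)⁻¹ • logVec (s.aChart w.1 (u m))) atTop
        (𝓝 (‖s.tropChart w.1 G‖⁻¹ • s.tropChart w.1 G)) := by
  refine forall_congr' fun w => ?_
  rw [nhds_induced, tendsto_comap_iff]
  rfl

theorem convergesTo_of_asymptoticTo (s : Seed I F) {u : ℕ → APos I} {G : ATrop I} (hG : G ≠ 0)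
    (h : AsymptoticTo (fun m => logVec (u m)) G) : s.ConvergesTo u (rayOfNeZero ℝ G hG) :=
  (convergesTo_iff s u hG).2 fun w =>
    (asymptoticTo_aChart s w.1 h).tendsto (tropChart_ne_zero s w.1 hG)

/-- The limit is unique up to positive multiples. -/
theorem exists_smul_of_convergesTo (s : Seed I F) {u : ℕ → APos I} {G G' : ATrop I} (hG : G ≠ 0)
    (hG' : G' ≠ 0) (h : s.ConvergesTo u (rayOfNeZero ℝ G hG))
    (h' : s.ConvergesTo u (rayOfNeZero ℝ G' hG')) : ∃ c : ℝ, 0 < c ∧ G = c • G' := by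
  have h1 := (convergesTo_iff s u hG).1 h ⟨[], by simp⟩
  have h2 := (convergesTo_iff s u hG').1 h' ⟨[], by simp⟩
  have h3 : ‖G‖⁻¹ • G = ‖G'‖⁻¹ • G' := tendsto_nhds_unique h1 h2
  have n1 := norm_pos_iff.2 hG
  have n2 := norm_pos_iff.2 hG'
  refine ⟨‖G‖ * ‖G'‖⁻¹, by positivity, ?_⟩
  rw [mul_smul, ← h3, smul_smul, mul_inv_cancel₀ n1.ne', one_smul]

theorem convergesTo_of_residues (s : Seed I F) {u : ℕ → APos I} {r : Module.Ray ℝ (ATrop I)}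
    {N : ℕ} (hN : 0 < N) (h : ∀ a, s.ConvergesTo (fun q => u (N * q + a)) r) :
    s.ConvergesTo u r :=
  fun w => tendsto_of_residues hN fun a => h a w

end Seed

namespace Seed

variable {I : Type*} [DecidableEq I] {F : Finset I}

/-! ### Dynamics of affine pairs -/

/-- The sum of the two basis vectors of `i` and `j`. -/
def pairVec (i j : Mutable F) : ATrop I := fun k => if k = i ∨ k = j then 1 else 0

theorem pairVec_symm (i j : Mutable F) : pairVec (I := I) i j = pairVec j i := by
  funext k
  simp [pairVec, or_comm]

theorem pairVec_ne_zero (i j : Mutable F) : pairVec (I := I) i j ≠ 0 := by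
  intro h
  have := congrFun h i
  simp [pairVec] at this

section Affine

variable [Fintype I]

theorem sum_mul_pairVec {i j : Mutable F} (hij : i ≠ j) (c : I → ℝ) :
    ∑ k, c k * pairVec i j k = c i + c j := by
  have hne : (i : I) ≠ j := fun h => hij (Subtype.ext h)
  have : ∀ k, c k * pairVec i j k = (if k = i then c k else 0) + if k = j then c k else 0 := by
    intro k
    by_cases h1 : k = i
    · subst h1; simp [pairVec, hne]
    · simp [pairVec, h1]
  simp only [this, Finset.sum_add_distrib, Finset.sum_ite_eq', Finset.mem_univ, if_true]

/-- Every coordinate outside the pair is zero, so a mutation sees only the double arrow and gives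
`-1 + max 2 0 = 1`. -/
theorem IsAffinePair.tropChart_alt {t : Seed I F} {i j : Mutable F} (hij : i ≠ j)
    (h : t.IsAffinePair i j) (n : ℕ) :
    t.tropChart (alt i j n) (pairVec i j) = pairVec i j := by
  induction n with
  | zero => rfl
  | succ n ih =>
    rw [alt, tropChart, ih]
    funext k
    by_cases hk : k = lab i j n
    · have hp : pairVec i j = pairVec (I := I) (lab i j n) (lab i j (n + 1)) := by
        by_cases hn : Even n
        · simp [lab, hn, Nat.even_add]
        · simp [lab, hn, Nat.even_add, pairVec_symm]
      have h1 := row_lab_succ t i j n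
      rw [row] at h1
      rw [tropMut, if_pos hk, hp, sum_mul_pairVec (lab_ne hij n), sum_mul_pairVec (lab_ne hij n),
        b_self, h1, hk]
      obtain ⟨s, hs, hb, -⟩ := h
      rcases hs with rfl | rfl <;> simp [hb, pairVec] <;> norm_num
    · rw [tropMut_of_ne _ _ _ hk]

/-- The oriented cycles place all the other neighbours in the exchange monomial opposite to the
square. Their exponents do not depend on `n` because the rows are constant. -/
theorem IsAffinePair.aSeq_add_two {t : Seed I F} {i j : Mutable F} (hij : i ≠ j)
    (h : t.IsAffinePair i j) (A : APos I) :
    ∃ K : ℝ, 0 < K ∧ ∀ n,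
      t.aSeq i j A (n + 2) * t.aSeq i j A n = t.aSeq i j A (n + 1) ^ 2 + K := by
  have hrow (n : ℕ) (c : ℤ) : restMonomial i j A (fun k => c * t.row i j n k)
      = restMonomial i j A (fun k => c * t.b i k) := by
    refine Finset.prod_congr rfl fun k hk => ?_
    simp only [Finset.mem_filter, Finset.mem_univ, true_and] at hk
    simp only [h.row_eq hij hk.1 hk.2]
  obtain ⟨s, hs, hb, hk⟩ := h
  refine ⟨restMonomial i j A (fun k => s * t.b i k), restMonomial_pos _ _ _ _, fun n => ?_⟩
  have hone : restMonomial i j A (fun k => -s * t.b i k) = 1 := by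
    refine Finset.prod_eq_one fun k hk' => ?_
    simp only [Finset.mem_filter, Finset.mem_univ, true_and] at hk'
    have := (hk k hk'.1 hk'.2).1
    rw [Int.toNat_of_nonpos (by linarith), pow_zero]
  have h1 := hrow n 1
  have h2 := hrow n (-1)
  simp only [one_mul] at h1
  have e := Seed.aSeq_add_two t hij A n
  have en : -t.row i j n = fun k => -1 * t.row i j n k := by
    funext k; simp
  rw [en, h2, h1] at e
  rcases hs with rfl | rfl
  · rw [hone, hb, show (-(2 * 1) : ℤ).toNat = 0 from rfl, show (2 * 1 : ℤ).toNat = 2 from rfl] at e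
    simp only [one_mul]
    rw [e]
    ring
  · simp only [neg_neg, one_mul] at hone
    rw [hone, hb, show (-(2 * -1) : ℤ).toNat = 2 from rfl,
      show (2 * -1 : ℤ).toNat = 0 from rfl] at e
    rw [e]
    ring

/-- In an affine pair, the alternating mutations diverge in the direction of `pairVec`. -/
theorem IsAffinePair.asymptoticTo {t : Seed I F} {i j : Mutable F} (hij : i ≠ j)
    (h : t.IsAffinePair i j) (A : APos I) {R : ℕ} (hR : 0 < R) (hE : Even R) :
    AsymptoticTo (fun m => logVec (t.aChart (alt i j (R * m)) A)) (pairVec i j) := by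
  obtain ⟨K, hK, hrec⟩ := h.aSeq_add_two hij A
  obtain ⟨hlim, C, hC⟩ := log_of_affine_recurrence hK (aSeq_pos t i j A) hrec
  -- The ray parameter is the logarithm of the coordinate at `i`. The coordinate at `j` deviates
  -- from it by at most `C`, and the unchanged ones contribute `‖logVec A‖`.
  refine ⟨fun m => Real.log (t.aSeq i j A (R * m)), hlim.comp ?_, C + ‖logVec A‖, ?_⟩
  · exact tendsto_id.const_mul_atTop' hR
  have hC0 : 0 ≤ C := (abs_nonneg _).trans (hC 0)
  have hA0 := norm_nonneg (logVec A)
  -- The bound on neighbouring logarithms starts at index `1`, so `R * m` must be positive.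
  filter_upwards [eventually_ge_atTop 1] with m hm
  refine (pi_norm_le_iff_of_nonneg (by positivity)).2 fun k => ?_
  have hEm : Even (R * m) := hE.mul_right m
  have hOm : ¬ Even (R * m + 1) := by simpa [Nat.even_add] using hEm
  rw [Pi.sub_apply, Pi.smul_apply, Real.norm_eq_abs, smul_eq_mul]
  by_cases hi : k = i
  · have : logVec (t.aChart (alt i j (R * m)) A) k = Real.log (t.aSeq i j A (R * m)) := by
      rw [aSeq, lab_even _ _ hEm, hi, logVec]
    rw [this]
    simp only [pairVec, hi, true_or, if_true, mul_one, sub_self, abs_zero]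
    positivity
  by_cases hj : k = j
  · have : logVec (t.aChart (alt i j (R * m)) A) k = Real.log (t.aSeq i j A (R * m + 1)) := by
      rw [aSeq_succ t hij, lab_odd _ _ hOm, hj, logVec]
    rw [this]
    simp only [pairVec, hj, or_true, if_true, mul_one]
    obtain ⟨n, hn⟩ : ∃ n, R * m = n + 1 := ⟨R * m - 1, by
      have := Nat.mul_pos hR hm
      omega⟩
    rw [hn]
    linarith [hC n]
  · have : logVec (t.aChart (alt i j (R * m)) A) k = logVec A k := by
      rw [logVec, aChart_alt_of_ne t i j A _ hi hj, logVec]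
    rw [this]
    simp only [pairVec, hi, hj, or_self, if_false, mul_zero, sub_zero]
    have := norm_le_pi_norm (logVec A) k
    rw [Real.norm_eq_abs] at this
    linarith

end Affine

/-! ### Vertices of the universal decorated complex -/

theorem label_eq_of_vertex_eq {w w' : Simplex F} {i i' : Mutable F}
    (h : vertex w i = vertex w' i') : i = i' :=
  congrArg (Quot.lift (fun p : Simplex F × Mutable F => p.2) (by rintro _ _ ⟨⟩; rfl)) h

theorem vertex_injective (w : Simplex F) : Function.Injective (vertex w) :=
  fun _ _ h => label_eq_of_vertex_eq h

/-- Reflections that keep a vertex with label `i` only add or remove leading letters different from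
`i`, so the suffix starting at the first `i` is an invariant of the vertex. -/
theorem dropWhile_eq_of_vertex_eq {w w' : Simplex F} {i : Mutable F}
    (h : vertex w i = vertex w' i) :
    w.1.dropWhile (fun a => decide (a ≠ i)) = w'.1.dropWhile (fun a => decide (a ≠ i)) :=
  congrArg (Quot.lift
    (fun p : Simplex F × Mutable F => p.1.1.dropWhile (fun a => decide (a ≠ p.2))) (by
      rintro _ _ ⟨w, k, i, hw, hi⟩
      simp [hi.symm])) h

theorem vertex_append {i : Mutable F} (u : List (Mutable F)) (hu : i ∉ u) (w w' : Simplex F)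
    (h : w'.1 = u ++ w.1) : vertex w' i = vertex w i := by
  induction u generalizing w' with
  | nil => rw [show w' = w from Subtype.ext h]
  | cons k u ih =>
    have hc : (k :: (u ++ w.1)).IsChain (· ≠ ·) := by
      have := w'.2
      rwa [h] at this
    have h1 : w' = ⟨k :: (u ++ w.1), hc⟩ := Subtype.ext h
    simp only [List.mem_cons, not_or] at hu
    rw [← ih hu.2 ⟨u ++ w.1, hc.tail⟩ rfl, h1]
    exact (Quot.sound (VertexRel.reflect ⟨u ++ w.1, hc.tail⟩ k i hc hu.1)).symm

/-- What remains of `w` starts with a letter `a` outside the pair, and the invariant of the vertex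
with label `a` exhibits it as a suffix on the other side. Used in both directions, this gives
equality. -/
theorem dropWhile_pair_suffix {i j : Mutable F} {w w' : List (Mutable F)}
    (h : ∀ a, a ≠ i → a ≠ j →
      w.dropWhile (fun b => decide (b ≠ a)) = w'.dropWhile (fun b => decide (b ≠ a))) :
    w.dropWhile (fun b => decide (b = i ∨ b = j)) <:+
      w'.dropWhile (fun b => decide (b = i ∨ b = j)) := by
  have key (v : List (Mutable F)) (a : Mutable F) (hi : a ≠ i) (hj : a ≠ j) :
      v.dropWhile (fun b => decide (b ≠ a))
        = (v.dropWhile (fun b => decide (b = i ∨ b = j))).dropWhile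
            (fun b => decide (b ≠ a)) := by
    conv_lhs => rw [← List.takeWhile_append_dropWhile
      (p := fun b => decide (b = i ∨ b = j)) (l := v)]
    refine List.dropWhile_append_of_pos fun b hb => ?_
    have := List.mem_takeWhile_imp hb
    simp only [decide_eq_true_eq] at this ⊢
    rintro rfl
    tauto
  match hw : w.dropWhile (fun b => decide (b = i ∨ b = j)) with
  | [] => exact List.nil_suffix
  | a :: v =>
    have ha : ¬ (a = i ∨ a = j) := by
      have := List.head_dropWhile_not (fun b => decide (b = i ∨ b = j)) (l := w)
        (by rw [hw]; simp)
      simp only [hw, List.head_cons] at this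
      simpa using this
    simp only [not_or] at ha
    have h1 := key w a ha.1 ha.2
    rw [hw, h a ha.1 ha.2, key w' a ha.1 ha.2] at h1
    simp only [List.dropWhile_cons, ne_eq, not_true, decide_false, Bool.false_eq_true,
      if_false] at h1
    rw [← h1]
    exact List.dropWhile_suffix _

/-- Among the simplices that share the vertices of `w` with labels different from `i` and `j`,
there is one from which all the others are reached by alternating words in `i` and `j`. -/
theorem exists_base (w : Simplex F) (i j : Mutable F) :
    ∃ w₀ : Simplex F, (∀ a, a ≠ i → a ≠ j → vertex w₀ a = vertex w a) ∧
      ∀ w' : Simplex F, (∀ a, a ≠ i → a ≠ j → vertex w' a = vertex w₀ a) →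
        ∃ m, w'.1 = alt i j m ++ w₀.1 ∨ w'.1 = alt j i m ++ w₀.1 := by
  have hsplit (v : List (Mutable F)) := List.takeWhile_append_dropWhile
    (p := fun b => decide (b = i ∨ b = j)) (l := v)
  have hmem (v : List (Mutable F)) (a : Mutable F)
      (ha : a ∈ v.takeWhile (fun b => decide (b = i ∨ b = j))) : a = i ∨ a = j := by
    simpa using List.mem_takeWhile_imp ha
  -- The base word is `w` without its maximal prefix in the letters `i` and `j`.
  have hbase : ∀ a, a ≠ i → a ≠ j → vertex (⟨w.1.dropWhile (fun b => decide (b = i ∨ b = j)),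
      w.2.suffix (List.dropWhile_suffix _)⟩ : Simplex F) a = vertex w a := fun a hi hj =>
    (vertex_append _ (fun h => by have := hmem w.1 a h; tauto) _ w (hsplit w.1).symm).symm
  refine ⟨_, hbase, fun w' hw' => ?_⟩
  have heq (a : Mutable F) (hi : a ≠ i) (hj : a ≠ j) :=
    dropWhile_eq_of_vertex_eq ((hw' a hi hj).trans (hbase a hi hj))
  have h1 := dropWhile_pair_suffix heq
  have h2 := dropWhile_pair_suffix fun a hi hj => (heq a hi hj).symm
  have h3 := h1.eq_of_length_le h2.length_le
  have hchain : (w'.1.takeWhile (fun b => decide (b = i ∨ b = j))).IsChain (· ≠ ·) :=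
    List.IsChain.left_of_append ((hsplit w'.1).symm ▸ w'.2)
  refine ⟨(w'.1.takeWhile (fun b => decide (b = i ∨ b = j))).length, ?_⟩
  rcases eq_alt_of_isChain _ hchain (hmem w'.1) with h | h
  · left
    rw [← h]
    change _ = _ ++ w.1.dropWhile _
    rw [← h3, hsplit]
  · right
    rw [← h]
    change _ = _ ++ w.1.dropWhile _
    rw [← h3, hsplit]

end Seed

namespace Seed

variable {I : Type*} [DecidableEq I] {F : Finset I} [Fintype I]

/-! ### Rank-two reductions -/

/-- A transformation of infinite order that maps a chart to another one along an alternating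
word is, up to squaring, an alternating loop. -/
theorem exists_loop_of_chart_eq {t : Seed I F} {i j : Mutable F} {m : ℕ}
    {σ : Equiv.Perm (Mutable F)} (hσ : σ i = i ∧ σ j = j ∨ σ i = j ∧ σ j = i) (hσ2 : σ * σ = 1)
    (hiso : IsIso σ t (t.seedAt (alt i j m)))
    {f : Equiv.Perm (APos I) × Equiv.Perm (XPos F)} (hf : ¬ IsOfFinOrder f)
    (h : t.chart (alt i j m) * f = permPair σ) :
    ∃ R, 0 < R ∧ Even R ∧ t.seedAt (alt i j R) = t ∧ t.seedAt (alt j i R) = t ∧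
      t.chart (alt i j R) = (f ^ 2)⁻¹ ∧ t.chart (alt j i R) = f ^ 2 := by
  have hSS := permPair_mul_self (I := I) hσ2
  have hfin (hf2 : f ^ 2 = 1) : False :=
    hf (isOfFinOrder_iff_pow_eq_one.2 ⟨2, two_pos, hf2⟩)
  have hM := hiso.permPair_mul_chart (alt i j m)
  rw [map_alt] at hM
  set M := t.chart (alt i j m) with hMdef
  set S := permPair (I := I) σ with hS
  have hfM : f = M⁻¹ * S := by rw [← h]; group
  -- In this case the relabelled word continues the alternation, as for a translation of the line.
  -- Otherwise it is the reversed word, as for a reflection, and `f` squares to the identity.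
  by_cases hlab : σ i = lab i j m ∧ σ j = lab i j (m + 1)
  · have hw : alt i j (m + m) = alt (σ i) (σ j) m ++ alt i j m := by
      rw [alt_add, hlab.1, hlab.2]
    have hseed : t.seedAt (alt i j (m + m)) = t := by
      rw [hw, seedAt_append]
      refine hiso.eq_of_sq ?_ hσ2
      have := hiso.seedAt (alt i j m)
      rwa [map_alt] at this
    have hchart : t.chart (alt i j (m + m)) = (f ^ 2)⁻¹ := by
      have hSi : S⁻¹ = S := inv_eq_of_mul_eq_one_left hSS
      have h2 : (t.seedAt (alt i j m)).chart (alt (σ i) (σ j) m) = S * M * S := by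
        rw [hM, mul_assoc, hSS, mul_one]
      rw [hw, chart_append, ← hMdef, h2, hfM, pow_two, mul_inv_rev, mul_inv_rev, hSi, inv_inv]
      group
    have hE : Even (m + m) := ⟨m, rfl⟩
    have hrev : (alt i j (m + m)).reverse = alt j i (m + m) := by
      rw [reverse_alt, lab_even _ _ hE, lab_odd _ _ (by simp [Nat.even_add])]
    have hs' := seedAt_reverse t (alt i j (m + m))
    have hc' := chart_reverse t (alt i j (m + m))
    rw [hrev, hseed] at hs' hc'
    refine ⟨m + m, ?_, hE, hseed, hs', hchart, ?_⟩
    · rcases Nat.eq_zero_or_pos m with rfl | hm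
      · refine (hfin ?_).elim
        rw [← inv_inj, ← hchart]
        simp [alt, chart]
      · omega
    · rw [hc', hchart, inv_inv]
  · exfalso
    have hlab' : σ i = lab i j (m + 1) ∧ σ j = lab i j m := by
      by_cases hm : Even m
      · rw [lab_even _ _ hm, lab_odd _ _ (by simpa [Nat.even_add] using hm)] at *
        tauto
      · rw [lab_odd _ _ hm, lab_even _ _ (by simpa [Nat.even_add] using hm)] at *
        tauto
    rw [hlab'.1, hlab'.2, ← reverse_alt, chart_reverse, ← hMdef] at hM
    refine hfin ?_
    rw [hfM, pow_two, ← hM]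
    calc S * M * (S * M) = S * (M * (S * M)) := by group
      _ = S * (M * (M⁻¹ * S)) := by rw [hM]
      _ = S * S := by group
      _ = 1 := hSS

/-- Labels are invariants of vertices, so the simplices containing `τ` all use the same labels for
it, and counting leaves exactly two free labels. The base simplex comes from `exists_base`. -/
theorem IsRankTwoReduction.exists_labels {s : Seed I F} {φ : s.modularGroup} {l : ℤ}
    {τ : Set (Vertex F)} (h : s.IsRankTwoReduction φ l τ) :
    ∃ (w₀ : Simplex F) (i j : Mutable F), i ≠ j ∧
      τ ⊆ verticesOf w₀ ∧ (∀ a, vertex w₀ a ∈ τ ↔ a ≠ i ∧ a ≠ j) ∧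
      ∀ w, τ ⊆ verticesOf w → (∀ a, a ≠ i → a ≠ j → vertex w a = vertex w₀ a) ∧
        ∃ m, w.1 = alt i j m ++ w₀.1 ∨ w.1 = alt j i m ++ w₀.1 := by
  obtain ⟨-, hcard, ⟨w, hw⟩, -⟩ := h
  set T : Set (Mutable F) := vertex w ⁻¹' τ with hT
  have hτ : τ = vertex w '' T := by
    rw [hT, Set.image_preimage_eq_inter_range]
    exact (Set.inter_eq_left.2 hw).symm
  have hTc : Tᶜ.ncard = 2 := by
    have h1 := Set.ncard_add_ncard_compl T
    rw [hτ, Set.ncard_image_of_injective _ (vertex_injective w), mutableRank] at hcard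
    omega
  obtain ⟨i, j, hij, hTij⟩ := Set.ncard_eq_two.1 hTc
  have hmem (a : Mutable F) : vertex w a ∈ τ ↔ a ≠ i ∧ a ≠ j := by
    have : a ∈ Tᶜ ↔ a = i ∨ a = j := by rw [hTij]; simp
    rw [Set.mem_compl_iff, hT, Set.mem_preimage] at this
    tauto
  obtain ⟨w₀, h0, hbase⟩ := exists_base w i j
  have hshare (v : Simplex F) (hv : τ ⊆ verticesOf v) (a : Mutable F) (hi : a ≠ i) (hj : a ≠ j) :
      vertex v a = vertex w a := by
    obtain ⟨a', ha'⟩ := hv ((hmem a).2 ⟨hi, hj⟩)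
    rwa [label_eq_of_vertex_eq ha'] at ha'
  refine ⟨w₀, i, j, hij, fun α hα => ?_, fun a => ⟨fun ha => ?_, fun ha => ?_⟩, fun v hv => ?_⟩
  · obtain ⟨a, rfl⟩ := hw hα
    obtain ⟨hi, hj⟩ := (hmem a).1 hα
    exact ⟨a, h0 a hi hj⟩
  · obtain ⟨a', ha'⟩ := hw ha
    rw [← ha'] at ha
    rw [← label_eq_of_vertex_eq ha']
    exact (hmem a').1 ha
  · rw [h0 a ha.1 ha.2]
    exact (hmem a).2 ha
  · have : ∀ a, a ≠ i → a ≠ j → vertex v a = vertex w₀ a := fun a hi hj =>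
      (hshare v hv a hi hj).trans (h0 a hi hj).symm
    exact ⟨this, hbase v this⟩

/-- A transformation that is represented by an automorphism is given in charts by a
permutation of the coordinates. -/
theorem chart_mul_eq_of_represents {s : Seed I F} {γ : Equiv.Perm (Vertex F)}
    {φ : s.modularGroup} (h : s.Represents γ φ) {w w' : Simplex F} {σ : Equiv.Perm (Mutable F)}
    (hσ : ∀ i, γ (vertex w i) = vertex w' (σ i)) :
    IsIso σ (s.seedAt w.1) (s.seedAt w'.1) ∧
      s.chart w'.1 * φ.1 = permPair σ * s.chart w.1 := by
  obtain ⟨h1, h2, h3⟩ := h.2 w w' σ hσ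
  refine ⟨h1, Prod.ext (Equiv.ext fun g => funext fun i => ?_)
    (Equiv.ext fun g => funext fun i => ?_)⟩
  · obtain ⟨i, rfl⟩ := (Equiv.Perm.ofSubtype σ).surjective i
    change (s.chart w'.1).1 (φ.1.1 g) _ = aPerm σ ((s.chart w.1).1 g) _
    rw [aPerm_apply, chart_fst, chart_fst]
    exact h2 g i
  · obtain ⟨i, rfl⟩ := σ.surjective i
    change (s.chart w'.1).2 (φ.1.2 g) _ = xPerm σ ((s.chart w.1).2 g) _
    rw [xPerm_apply, chart_snd, chart_snd]
    exact h3 g i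

/-- A cluster Dehn twist is, up to powers, an alternating loop in each of its rank-two
reductions. -/
theorem IsRankTwoReduction.exists_loop {s : Seed I F} {φ : s.modularGroup} {l : ℤ}
    {τ : Set (Vertex F)} (h : s.IsRankTwoReduction φ l τ) (hφ : ¬ IsOfFinOrder φ) :
    ∃ (w₀ : Simplex F) (i j : Mutable F), i ≠ j ∧
      (∀ α ∈ linkVertices τ, ∃ (w : Simplex F) (a : Mutable F) (m : ℕ), (a = i ∨ a = j) ∧
        α = vertex w a ∧ (w.1 = alt i j m ++ w₀.1 ∨ w.1 = alt j i m ++ w₀.1)) ∧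
      ∃ R, 0 < R ∧ Even R ∧ (s.seedAt w₀.1).seedAt (alt i j R) = s.seedAt w₀.1 ∧
        (s.seedAt w₀.1).seedAt (alt j i R) = s.seedAt w₀.1 ∧
        (s.seedAt w₀.1).chart (alt i j R) * s.chart w₀.1
          = s.chart w₀.1 * ((φ ^ l).1 ^ 2)⁻¹ ∧
        (s.seedAt w₀.1).chart (alt j i R) * s.chart w₀.1 = s.chart w₀.1 * (φ ^ l).1 ^ 2 := by
  obtain ⟨w₀, i, j, hij, hτ₀, hτ, hw⟩ := h.exists_labels
  obtain ⟨hl, -, -, γ, hγ, hfix⟩ := h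
  have hlink : ∀ α ∈ linkVertices τ, ∃ (w : Simplex F) (a : Mutable F) (m : ℕ),
      (a = i ∨ a = j) ∧ α = vertex w a ∧
        (w.1 = alt i j m ++ w₀.1 ∨ w.1 = alt j i m ++ w₀.1) := by
    rintro α ⟨hα, w, hτw, a, rfl⟩
    obtain ⟨h1, m, hm⟩ := hw w hτw
    refine ⟨w, a, m, ?_, rfl, hm⟩
    by_contra! ha
    exact hα (by rw [h1 a ha.1 ha.2]; exact (hτ a).2 ha)
  obtain ⟨w', hw'⟩ := hγ.1.1 w₀
  -- The automorphism carries `w₀` to `w'` and induces a permutation of labels. It fixes the labels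
  -- of `τ`, so it fixes or swaps `i` and `j`.
  have hex (a : Mutable F) : ∃ b, vertex w' b = γ (vertex w₀ a) := by
    have : γ (vertex w₀ a) ∈ verticesOf w' := hw' ▸ Set.mem_image_of_mem _ ⟨a, rfl⟩
    exact this
  choose f hf using hex
  have hinj : Function.Injective f := fun a b hab =>
    vertex_injective w₀ (γ.injective (by rw [← hf, ← hf, hab]))
  have hfin : Finite (Mutable F) := inferInstance
  set σ : Equiv.Perm (Mutable F) :=
    Equiv.ofBijective f (Finite.injective_iff_bijective.1 hinj) with hσdef
  have hσ (a : Mutable F) : γ (vertex w₀ a) = vertex w' (σ a) := (hf a).symm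
  have hσfix (a : Mutable F) (ha : a ≠ i ∧ a ≠ j) : σ a = a := by
    have h1 := hσ a
    rw [hfix _ ((hτ a).2 ha)] at h1
    exact (label_eq_of_vertex_eq h1).symm
  have hτ' : τ ⊆ verticesOf w' := by
    intro α hα
    rw [← hw']
    exact ⟨α, hτ₀ hα, hfix α hα⟩
  have hσi : σ i = i ∨ σ i = j := by
    by_contra! hc
    exact hc.1 (σ.injective (hσfix _ hc))
  have hσj : σ j = i ∨ σ j = j := by
    by_contra! hc
    exact hc.2 (σ.injective (hσfix _ hc))
  have hσij : σ i ≠ σ j := fun h => hij (σ.injective h)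
  have hcase : σ i = i ∧ σ j = j ∨ σ i = j ∧ σ j = i := by
    rcases hσi with h1 | h1 <;> rcases hσj with h2 | h2 <;> simp_all
  have hσ2 : σ * σ = 1 := by
    ext1 a
    rw [Equiv.Perm.mul_apply, Equiv.Perm.one_apply]
    by_cases hai : a = i
    · subst hai; rcases hcase with h1 | h1 <;> simp [h1]
    by_cases haj : a = j
    · subst haj; rcases hcase with h1 | h1 <;> simp [h1]
    rw [hσfix a ⟨hai, haj⟩, hσfix a ⟨hai, haj⟩]
  obtain ⟨hiso, hchart⟩ := chart_mul_eq_of_represents hγ hσ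
  obtain ⟨-, m, hm⟩ := hw w' hτ'
  set t := s.seedAt w₀.1 with ht
  set C := s.chart w₀.1 with hC
  -- The power of `φ`, conjugated into the chart of the base simplex.
  set f := C * (φ ^ l).1 * C⁻¹ with hfdef
  have hford : ¬ IsOfFinOrder f := by
    intro hford
    apply hφ
    obtain ⟨n, hn, hpow⟩ := isOfFinOrder_iff_pow_eq_one.1 hford
    rw [hfdef, conj_pow, conj_eq_one_iff] at hpow
    rw [isOfFinOrder_iff_zpow_eq_one]
    refine ⟨l * n, mul_ne_zero hl (by exact_mod_cast hn.ne'), Subtype.ext ?_⟩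
    rw [zpow_mul, zpow_natCast]
    exact hpow
  have hf2 : f ^ 2 * C = C * (φ ^ l).1 ^ 2 := by rw [hfdef, conj_pow]; group
  have hf2' : (f ^ 2)⁻¹ * C = C * ((φ ^ l).1 ^ 2)⁻¹ := by rw [hfdef, conj_pow]; group
  have main (p q : Mutable F) (hpq : σ p = p ∧ σ q = q ∨ σ p = q ∧ σ q = p)
      (hm : w'.1 = alt p q m ++ w₀.1) := by
    rw [hm, seedAt_append] at hiso
    rw [hm, chart_append] at hchart
    refine exists_loop_of_chart_eq hpq hσ2 hiso hford ?_
    rw [hfdef, ← mul_assoc, ← mul_assoc, hchart, mul_inv_cancel_right]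
  rcases hm with hm | hm
  · obtain ⟨R, hR, hE, h1, h2, h3, h4⟩ := main i j hcase hm
    exact ⟨w₀, i, j, hij, hlink, R, hR, hE, h1, h2, by rw [h3, hf2'], by rw [h4, hf2]⟩
  · obtain ⟨R, hR, hE, h1, h2, h3, h4⟩ := main j i (by tauto) hm
    refine ⟨w₀, j, i, hij.symm, fun α hα => ?_, R, hR, hE, h1, h2, by rw [h3, hf2'],
      by rw [h4, hf2]⟩
    obtain ⟨w, a, m, ha, hαw, hm⟩ := hlink α hα
    exact ⟨w, a, m, ha.symm, hαw, hm.symm⟩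

/-! ### Limits of cluster Dehn twists -/

theorem aAct_zpow_add {s : Seed I F} (φ : s.modularGroup) (a b : ℤ) (g : APos I) :
    aAct (φ ^ (a + b)) g = aAct (φ ^ a) (aAct (φ ^ b) g) := by
  rw [zpow_add]
  rfl

/-- If a power of a mapping class acts in some chart as an alternating loop in an affine pair,
then its orbits converge to the same boundary point. -/
theorem convergesTo_of_loop {s : Seed I F} {w : List (Mutable F)} {i j : Mutable F} (hij : i ≠ j)
    (hA : (s.seedAt w).IsAffinePair i j) {R : ℕ} (hR : 0 < R) (hE : Even R)
    (hseed : (s.seedAt w).seedAt (alt i j R) = s.seedAt w) {φ : s.modularGroup} {N : ℤ}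
    (hφ : (s.seedAt w).chart (alt i j R) * s.chart w = s.chart w * (φ ^ N).1) {G : ATrop I}
    (hG : G ≠ 0) (hGw : s.tropChart w G = pairVec i j) (g : APos I) :
    s.ConvergesTo (fun q : ℕ => aAct (φ ^ (N * q)) g) (rayOfNeZero ℝ G hG) := by
  refine convergesTo_of_asymptoticTo s hG (asymptoticTo_of_aChart s w ?_)
  rw [hGw]
  convert hA.asymptoticTo hij (s.aChart w g) hR hE using 3 with q
  have hpow : s.chart w * (φ ^ (N * q)).1 = (s.seedAt w).chart (alt i j (R * q)) * s.chart w := by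
    rw [(chart_alt_pow _ hE hseed q).2, zpow_mul, zpow_natCast]
    have h1 : (φ ^ N).1 = (s.chart w)⁻¹ * (s.seedAt w).chart (alt i j R) * s.chart w := by
      rw [mul_assoc, hφ, inv_mul_cancel_left]
    have h2 : ((φ ^ N) ^ q).1 = (φ ^ N).1 ^ q := rfl
    have h3 := conj_pow (b := (s.seedAt w).chart (alt i j R)) (a := (s.chart w)⁻¹) (i := q)
    rw [inv_inv] at h3
    rw [h2, h1, h3]
    group
  have := congrArg (fun p : Equiv.Perm (APos I) × Equiv.Perm (XPos F) => p.1 g) hpow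
  simp only [Prod.fst_mul, Equiv.Perm.mul_apply, chart_fst] at this
  exact this

/-- Each rank-two reduction of a cluster Dehn twist determines a limit point, and this point is
cluster-filling for the reduction. -/
theorem IsRankTwoReduction.exists_limit {s : Seed I F}
    (hs : (s.IsConnected ∧ 3 ≤ mutableRank F) ∨ s.IsTypeL 2) {φ : s.modularGroup} {l : ℤ}
    {τ : Set (Vertex F)} (h : s.IsRankTwoReduction φ l τ) (hφ : ¬ IsOfFinOrder φ) :
    ∃ (G : ATrop I) (hG : G ≠ 0), s.IsClusterFillingRel τ G ∧ ∀ g : APos I,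
      s.ConvergesTo (fun m => aAct (φ ^ (m : ℤ)) g) (rayOfNeZero ℝ G hG) ∧
      s.ConvergesTo (fun m => aAct (φ ^ (-(m : ℤ))) g) (rayOfNeZero ℝ G hG) := by
  obtain ⟨w₀, i, j, hij, hlink, R, hR, hE, hseed, hseed', hc, hc'⟩ := h.exists_loop hφ
  have hl : l ≠ 0 := h.1
  have hpow : ((φ ^ l).1 ^ 2) = (φ ^ (2 * l)).1 := by
    have : (φ ^ l) ^ 2 = φ ^ (2 * l) := by rw [mul_comm, zpow_mul]; norm_cast
    rw [← this]; rfl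
  have hpow' : ((φ ^ l).1 ^ 2)⁻¹ = (φ ^ (-(2 * l))).1 := by
    rw [hpow, zpow_neg]; rfl
  have hb : 2 ≤ |(s.seedAt w₀.1).b j i| := by
    by_contra! hb
    have hfin := isOfFinOrder_chart_alt (s.seedAt w₀.1) hij hE hseed (by omega)
    obtain ⟨n, hn, hn1⟩ := isOfFinOrder_iff_pow_eq_one.1 hfin
    apply hφ
    rw [isOfFinOrder_iff_zpow_eq_one]
    refine ⟨-(2 * l) * n, by simp [hl, hn.ne'], Subtype.ext ?_⟩
    rw [zpow_mul, zpow_natCast]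
    have h2 : ((φ ^ (-(2 * l))) ^ n).1 = (φ ^ (-(2 * l))).1 ^ n := rfl
    have h1 : (s.seedAt w₀.1).chart (alt i j R)
        = s.chart w₀.1 * (φ ^ (-(2 * l))).1 * (s.chart w₀.1)⁻¹ := by
      rw [← hpow', ← hc, mul_inv_cancel_right]
    rw [h1, conj_pow, conj_eq_one_iff] at hn1
    rw [h2, hn1]; rfl
  have hA : (s.seedAt w₀.1).IsAffinePair i j := by
    refine isAffinePair_of_seedAt_alt_eq _ hij hR hE hseed hb ?_
    rcases hs with ⟨hcon, hrank⟩ | hL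
    · exact Or.inr (exists_b_ne_zero_of_isConnected (seedAt_isConnected hcon _) hrank i j)
    · left
      have h1 := abs_seedAt_of_isTypeL hL w₀.1 (a := j) (b := i)
        (fun h => hij (Subtype.ext h.symm))
      rw [← cast_b] at h1
      exact_mod_cast h1
  -- The limit has coordinates `pairVec i j` at the base simplex; mutating back along the reversed
  -- word expresses it in the initial chart.
  set G : ATrop I := (s.seedAt w₀.1).tropChart w₀.1.reverse (pairVec i j) with hGdef
  have hG : G ≠ 0 := tropChart_ne_zero _ _ (pairVec_ne_zero i j)
  have hGw : s.tropChart w₀.1 G = pairVec i j := by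
    have := tropChart_reverse (s.seedAt w₀.1) w₀.1.reverse (pairVec i j)
    rwa [seedAt_reverse, List.reverse_reverse] at this
  refine ⟨G, hG, fun α hα => ?_, fun g => ?_⟩
  · obtain ⟨w, a, m, ha, rfl, hw⟩ := hlink α hα
    change s.tropChart w.1 G a ≠ 0
    have hval : s.tropChart w.1 G = pairVec i j := by
      rcases hw with hw | hw
      · rw [hw, tropChart_append, hGw, hA.tropChart_alt hij]
      · rw [hw, tropChart_append, hGw, pairVec_symm, hA.symm.tropChart_alt hij.symm]
    rw [hval]
    rcases ha with rfl | rfl <;> simp [pairVec]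
  have c1 (g : APos I) : s.ConvergesTo (fun q : ℕ => aAct (φ ^ (-(2 * l) * q)) g)
      (rayOfNeZero ℝ G hG) :=
    convergesTo_of_loop hij hA hR hE hseed (by rw [hc, hpow']) hG hGw g
  -- The inverse loop alternates in the opposite order. The affine condition and `pairVec` are
  -- symmetric in the pair, so both directions have the same limit.
  have c2 (g : APos I) : s.ConvergesTo (fun q : ℕ => aAct (φ ^ (2 * l * q)) g)
      (rayOfNeZero ℝ G hG) :=
    convergesTo_of_loop hij.symm hA.symm hR hE hseed' (by rw [hc', hpow]) hG
      (hGw.trans (pairVec_symm i j)) g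
  have key (e : ℤ) (he : e = 1 ∨ e = -1) :
      s.ConvergesTo (fun m : ℕ => aAct (φ ^ (e * m)) g) (rayOfNeZero ℝ G hG) := by
    -- Only powers divisible by `2 * l` are known to be loops. The other exponents are handled by
    -- residue class, moving the remainder into the starting point.
    refine convergesTo_of_residues s (N := 2 * l.natAbs) (by omega) fun a => ?_
    have hsplit (q : ℕ) : aAct (φ ^ (e * ((2 * l.natAbs * q + a : ℕ) : ℤ))) g
        = aAct (φ ^ (e * (2 * |l|) * q)) (aAct (φ ^ (e * a)) g) := by
      rw [← aAct_zpow_add]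
      congr 2
      push_cast
      ring
    simp only [hsplit]
    have hcases : e * (2 * |l|) = 2 * l ∨ e * (2 * |l|) = -(2 * l) := by
      rcases he with rfl | rfl <;> rcases abs_choice l with h | h <;> rw [h] <;> simp
    rcases hcases with h | h <;> rw [h]
    · exact c2 _
    · exact c1 _
  refine ⟨?_, ?_⟩
  · simpa using key 1 (Or.inl rfl)
  · simpa using key (-1) (Or.inr rfl)

end Seed

/-! ### The limit point is independent of the reduction -/

theorem mainTheorem3 {I : Type*} [Fintype I] [DecidableEq I] {F : Finset I} (s : Seed I F)
    (hs : (s.IsConnected ∧ 3 ≤ mutableRank F) ∨ s.IsTypeL 2)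
    (φ : s.modularGroup) (hφ : s.IsClusterDehnTwist φ) :
    ∃ (G : ATrop I) (hG : G ≠ 0),
      (∀ l τ, s.IsRankTwoReduction φ l τ → s.IsClusterFillingRel τ G) ∧
      (s.IsTypeL 2 → s.IsClusterFilling G) ∧
      ∀ g : APos I,
        s.ConvergesTo (fun m => Seed.aAct (φ ^ (m : ℤ)) g) (rayOfNeZero ℝ G hG) ∧
        s.ConvergesTo (fun m => Seed.aAct (φ ^ (-(m : ℤ))) g) (rayOfNeZero ℝ G hG) := by
  obtain ⟨hord, l, τ, hτ⟩ := hφ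
  obtain ⟨G, hG, hfill, hconv⟩ := hτ.exists_limit hs hord
  refine ⟨G, hG, fun l' τ' hτ' => ?_, fun hL α => ?_, hconv⟩
  · obtain ⟨G', hG', hfill', hconv'⟩ := hτ'.exists_limit hs hord
    -- One orbit, here of the point with all coordinates `1`, determines the limit up to a positive
    -- factor, which does not affect the nonvanishing of tropical variables.
    obtain ⟨c, hc, rfl⟩ := s.exists_smul_of_convergesTo hG hG' (hconv fun _ => 1).1
      (hconv' fun _ => 1).1
    intro α hα
    have h1 := hfill' α hα
    induction α using Quot.ind with
    | mk p =>
      change s.tropChart p.1.1 (c • G') p.2 ≠ 0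
      rw [Seed.tropChart_smul s _ hc]
      exact mul_ne_zero hc.ne' h1
  · obtain ⟨-, hcard, ⟨w, hw⟩, -⟩ := hτ
    obtain ⟨hF, x, y, hxy, hcov, -⟩ := hL
    -- Since `Set.ncard` is `0` on infinite sets, finiteness is needed to deduce `τ = ∅`; then every
    -- vertex lies in the link.
    have hfin : τ.Finite := (Set.finite_range _).subset hw
    have hrank : mutableRank F ≤ 2 := by
      have h1 : mutableRank F ≤ Nat.card I :=
        Nat.card_le_card_of_injective _ Subtype.val_injective
      have h2 : (Set.univ : Set I) ⊆ {x, y} := fun z _ => hcov z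
      have h3 := Set.ncard_le_ncard h2
      rw [Set.ncard_univ, Set.ncard_pair hxy] at h3
      omega
    have hempty : τ = ∅ := (Set.ncard_eq_zero hfin).1 (by omega)
    refine hfill α ?_
    induction α using Quot.ind with
    | mk p => exact ⟨hempty ▸ Set.notMem_empty _, p.1, by simp [hempty], p.2, rfl⟩
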